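/- **Setting.** Let $k\ge 2$ be an integer, $L>0$, $\beta>0$, and let $\Phi_0:(-L-\beta,L+\beta)^k\to\mathbb R$ be of class $C^2$. Let $\gamma_n$ be the volume of the unit ball of $\mathbb R^n$, let $m$ be Lebesgue measure and $d$ the Euclidean distance on $\mathbb R^k$, let $B(x,r)$ be the open Euclidean ball, and put $B_\varepsilon(X)=\{x\in\mathbb R^k: d(x,X)<\varepsilon\}$ (empty if $X=\emptyset$). Let $Y=k+2$ (the maximal number of boundary pieces meeting at one point: at most $k$ faces of a box and one slanted boundary, counted twice), put $$\eta_0(s)=\frac1{\sqrt s}+\frac{4}{\sqrt s-1}\,Y\,\frac{\gamma_{k-1}}{\gamma_k}\qquad(s>1),$$ and let $S_k(Y)$ be the unique $s>1$ with $\eta_0(s)=1$. Let $\sigma>S_k(Y)$, $C_1>1$, $C_2>1$, let $\gamma>0$ be given by $\gamma^{-2}=C_1\sigma$, and assume that for all $x\in(-L-\beta,L+\beta)^k$ $$\Big(\frac{\partial\Phi_0}{\partial x_1}(x)\Big)^2\ge C_1^{k-1}C_2\,\sigma^k,\qquad \Big(\frac{\partial\Phi_0}{\partial x_j}(x)\Big)^2\le\frac{(C_1-1)(C_2-1)}{k-1}\,\sigma\quad(2\le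 j\le k).$$ Put $\Gamma(u)=(u_1,\gamma^{-1}u_2,\dots,\gamma^{-(k-1)}u_k)$, $\Omega=\prod_{j=1}^k[-\gamma^{j-1}L,\gamma^{j-1}L]$ and $\Omega_r=\Gamma^{-1}((-L-r,L+r)^k)$. For $\theta\in\mathbb R$ and $j\in\mathbb Z$ let $$U_j^\theta=\{x\in\Omega_0:\ (2j-1)L<\theta+\Phi_0(\Gamma(x))<(2j+1)L\}.$$ Let $\varphi_\theta(x)=\Phi_0(x)+\theta-2L\big\lfloor\frac{\Phi_0(x)+\theta+L}{2L}\big\rfloor$ and $$T_\theta(u)=\Big(\frac{u_2}\gamma,\dots,\frac{u_k}\gamma,\ \gamma^{k-1}\varphi_\theta(\Gamma(u))\Big),\qquad T_j^\theta(u)=\Big(\frac{u_2}\gamma,\dots,\frac{u_k}\gamma,\ \gamma^{k-1}\big(\Phi_0(\Gamma(u))+\theta-2jL\big)\Big)\quad(u\in\Omega_\beta).$$ **Theorem.** There are positive real numbers $r_0,\varepsilon_m,K,\varepsilon_0$, not depending on $\theta$, such that for every $\theta\in\mathbb R$, with $V_j^\theta=B_{\varepsilon_m}(U_j^\theta)$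 and with $T_j^\theta$ regarded as a map on $V_j^\theta$, the following hold. * **(PRE)** Only finitely many $U_j^\theta$ are nonempty. The $U_j^\theta$ are pairwise disjoint open subsets of $\Omega$. For every $j$, $\overline{U_j^\theta}\subset V_j^\theta\subset\Omega_\beta$, and $T_j^\theta$ is $C^2$ on $V_j^\theta$. * **(PE1)** For every $j$, $T_\theta|_{U_j^\theta}=T_j^\theta|_{U_j^\theta}$ and $B_{r_0}(T_\theta(U_j^\theta))\subset T_j^\theta(V_j^\theta)$. * **(PE2)** For every $j$, $T_j^\theta$ is a $C^2$ diffeomorphism of $V_j^\theta$ onto its (open) image, and for all $\varepsilon\in(0,\varepsilon_0)$, $z\in T_j^\theta(V_j^\theta)$ and $x,y\in B(z,\varepsilon)\cap T_j^\theta(V_j^\theta)$, $$\big|\det D(T_j^\theta)^{-1}(x)-\det D(T_j^\theta)^{-1}(y)\big|\le K\,\big|\det D(T_j^\theta)^{-1}(z)\big|\,\varepsilon.$$ * **(PE3)** $m\big(\Omega\setminus\bigcup_jU_j^\theta\big)=0$. * **(PE4)** For every $j$ and all $u,v\in T_j^\theta(V_j^\theta)$ with $d(u,v)\le\varepsilon_0$,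 $\ d\big((T_j^\theta)^{-1}(u),(T_j^\theta)^{-1}(v)\big)\le\frac1{\sqrt\sigma}\,d(u,v)$. * **(PE5)** For $0<\varepsilon\le\delta\le\varepsilon_0$ put $$G(\varepsilon,\delta)=\sup_{x\in\mathbb R^k}\ \sum_j\frac{m\Big((T_j^\theta)^{-1}\big[B_\varepsilon(\partial T_j^\theta(U_j^\theta))\big]\cap B\big(x,(1-\tfrac1{\sqrt\sigma})\delta\big)\Big)}{m\Big(B\big(x,(1-\tfrac1{\sqrt\sigma})\delta\big)\Big)},\qquad \eta(\delta)=\frac1{\sqrt\sigma}+2\sup_{0<\varepsilon\le\delta}\frac{G(\varepsilon,\delta)}{\varepsilon}\,\delta,$$ where $(T_j^\theta)^{-1}[A]=\{u\in V_j^\theta:T_j^\theta(u)\in A\}$. Then $\sup_{0<\delta\le\varepsilon_0}\eta(\delta)<1$. -/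

import Mathlib

open MeasureTheory Set
open scoped ENNReal

noncomputable section

/-! ### Boxes, the dilation `Γ`, and the partition -/

/-- Euclidean space `ℝ^k`. The coordinate of index `i : Fin k` is the `(i+1)`-th coordinate in the
usual one-based numbering. -/
abbrev Euc (k : ℕ) : Type := EuclideanSpace ℝ (Fin k)

/-- The open cube `(-r, r)^k`. -/
def openCube (k : ℕ) (r : ℝ) : Set (Euc k) := {x | ∀ i, -r < x i ∧ x i < r}

/-- The partial derivative of `Φ` with respect to the coordinate of index `i`. -/
def partialDeriv {k : ℕ} (Φ : Euc k → ℝ) (i : Fin k) (x : Euc k) : ℝ :=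
  fderiv ℝ Φ x (EuclideanSpace.single i 1)

/-- The dilation `Γ(x)_j = x_j γ^{-(j-1)}` (one-based `j`). -/
def dilation {k : ℕ} (γ : ℝ) (x : Euc k) : Euc k :=
  WithLp.toLp 2 (fun i => x i / γ ^ (i : ℕ))

/-- The compact box `Ω = ∏_j [-γ^{j-1} L, γ^{j-1} L]` (one-based `j`). -/
def box (k : ℕ) (L γ : ℝ) : Set (Euc k) :=
  {x | ∀ i : Fin k, -(γ ^ (i : ℕ) * L) ≤ x i ∧ x i ≤ γ ^ (i : ℕ) * L}

/-- The open box `Ω_r = Γ⁻¹((-L-r, L+r)^k)`. -/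
def openBox (k : ℕ) (L γ r : ℝ) : Set (Euc k) :=
  dilation γ ⁻¹' openCube k (L + r)

/-- The open piece `U_j^θ = {x ∈ Ω_0 : (2j-1)L < θ + Φ₀(Γ x) < (2j+1)L}`. -/
def piece {k : ℕ} (Φ₀ : Euc k → ℝ) (L γ θ : ℝ) (j : ℤ) : Set (Euc k) :=
  {x | x ∈ openBox k L γ 0 ∧
    (2 * (j : ℝ) - 1) * L < θ + Φ₀ (dilation γ x) ∧
    θ + Φ₀ (dilation γ x) < (2 * (j : ℝ) + 1) * L}

/-- The enlarged piece `V_j^θ = B_{ε_m}(U_j^θ) = {x : d(x, U_j^θ) < ε_m}` (empty if `U_j^θ` is). -/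
def enlargedPiece {k : ℕ} (Φ₀ : Euc k → ℝ) (L γ θ εm : ℝ) (j : ℤ) : Set (Euc k) :=
  Metric.thickening εm (piece Φ₀ L γ θ j)

/-! ### The transformations -/

/-- `φ_θ(x) = Φ₀(x) + θ - 2jL` with `j = ⌊(Φ₀(x) + θ + L) / (2L)⌋`. -/
def foldedMap {k : ℕ} (Φ₀ : Euc k → ℝ) (L θ : ℝ) (x : Euc k) : ℝ :=
  Φ₀ x + θ - 2 * (⌊(Φ₀ x + θ + L) / (2 * L)⌋ : ℝ) * L

/-- The map `u ↦ (u_2/γ, …, u_k/γ, γ^{k-1} ψ(Γ u))`. -/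
def shiftMap {k : ℕ} (γ : ℝ) (ψ : Euc k → ℝ) (u : Euc k) : Euc k :=
  WithLp.toLp 2 (fun i : Fin k =>
    if h : (i : ℕ) + 1 < k then u ⟨(i : ℕ) + 1, h⟩ / γ
    else γ ^ (k - 1) * ψ (dilation γ u))

/-- The transformation `T_θ(u) = (u_2/γ, …, u_k/γ, γ^{k-1} φ_θ(Γ u))`. -/
def transf {k : ℕ} (Φ₀ : Euc k → ℝ) (L γ θ : ℝ) : Euc k → Euc k :=
  shiftMap γ (foldedMap Φ₀ L θ)

/-- The branch `T_j^θ(u) = (u_2/γ, …, u_k/γ, γ^{k-1} (Φ₀(Γ u) + θ - 2jL))`. -/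
def branch {k : ℕ} (Φ₀ : Euc k → ℝ) (L γ θ : ℝ) (j : ℤ) : Euc k → Euc k :=
  shiftMap γ (fun x => Φ₀ x + (θ - 2 * (j : ℝ) * L))

/-- The inverse `(T_j^θ)⁻¹ : T_j^θ(V_j^θ) → V_j^θ` of the branch restricted to `V_j^θ`
(with an irrelevant value outside `T_j^θ(V_j^θ)`). -/
def branchInv {k : ℕ} (Φ₀ : Euc k → ℝ) (L γ θ εm : ℝ) (j : ℤ) : Euc k → Euc k :=
  Function.invFunOn (branch Φ₀ L γ θ j) (enlargedPiece Φ₀ L γ θ εm j)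

/-- `f` is a `C²` diffeomorphism of the open set `V` onto its image, which is open. -/
def IsC2DiffeoOn {k : ℕ} (f : Euc k → Euc k) (V : Set (Euc k)) : Prop :=
  IsOpen V ∧ InjOn f V ∧ ContDiffOn ℝ 2 f V ∧ IsOpen (f '' V) ∧
    ContDiffOn ℝ 2 (Function.invFunOn f V) (f '' V)

/-! ### The geometric constant -/

/-- `G(x, ε, δ) = ∑_j m((T_j^θ)⁻¹[B_ε(∂ T_j^θ(U_j^θ))] ∩ B(x, (1 - 1/√σ) δ)) / m(B(x, (1 - 1/√σ) δ))`,
where `(T_j^θ)⁻¹[A]` is the set of points of `V_j^θ` that `T_j^θ` sends into `A`.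
The terms with `U_j^θ = ∅` vanish. -/
def boundaryRatio {k : ℕ} (Φ₀ : Euc k → ℝ) (L γ θ εm σ : ℝ) (x : Euc k) (ε δ : ℝ) : ℝ≥0∞ :=
  ∑' j : ℤ,
    volume ((enlargedPiece Φ₀ L γ θ εm j ∩
        branch Φ₀ L γ θ j ⁻¹'
          Metric.thickening ε (frontier (branch Φ₀ L γ θ j '' piece Φ₀ L γ θ j))) ∩
        Metric.ball x ((1 - 1 / √σ) * δ)) /
      volume (Metric.ball x ((1 - 1 / √σ) * δ))

/-- `η(δ) = 1/√σ + 2 sup_{0 < ε ≤ δ} (G(ε, δ) / ε) δ`, with `G(ε, δ) = sup_x G(x, ε, δ)`,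
as an element of `[0, ∞]`. -/
def geomConst {k : ℕ} (Φ₀ : Euc k → ℝ) (L γ θ εm σ : ℝ) (δ : ℝ) : ℝ≥0∞ :=
  ENNReal.ofReal (1 / √σ) +
    2 * ⨆ ε ∈ Ioc (0 : ℝ) δ,
      (⨆ x : Euc k, boundaryRatio Φ₀ L γ θ εm σ x ε δ) / ENNReal.ofReal ε * ENNReal.ofReal δ

/-! ### The threshold for the expansion coefficient -/

/-- The volume of the unit ball of `ℝ^n`. -/
def unitBallVol (n : ℕ) : ℝ := (volume (Metric.ball (0 : Euc n) 1)).toReal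

/-- The maximal number of crossings in dimension `k`: at most `k` hyperplanes bounding `Ω` and one
slanted boundary, counted twice, meet at one point. -/
def crossings (k : ℕ) : ℕ := k + 2

/-- `η₀(s, Y) = 1/√s + 4/(√s - 1) · Y · γ_{k-1}/γ_k`, with `γ_n` the volume of the unit ball. -/
def eta0 (k Y : ℕ) (s : ℝ) : ℝ :=
  1 / √s + 4 / (√s - 1) * (Y : ℝ) * (unitBallVol (k - 1) / unitBallVol k)

/-- `S_k(Y)`, the number `s > 1` for which `η₀(s, Y) = 1`. -/
def threshold (k Y : ℕ) : ℝ := Function.invFunOn (eta0 k Y) (Ioi 1) 1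

theorem unitBallVol_pos (n : ℕ) : 0 < unitBallVol n :=
  ENNReal.toReal_pos (Metric.measure_ball_pos volume _ one_pos).ne' measure_ball_lt_top.ne

/-- For `Y ≥ 1` the equation `η₀(s, Y) = 1` has exactly one solution `s > 1`, and the solution is
`S_k(Y)`. -/
theorem threshold_spec (k Y : ℕ) (hY : 0 < Y) :
    1 < threshold k Y ∧ eta0 k Y (threshold k Y) = 1 ∧
      ∀ s : ℝ, 1 < s → eta0 k Y s = 1 → s = threshold k Y := by
  have key : ∃ a : ℝ, 0 < a ∧ ∀ s, eta0 k Y s = 1 / √s + a / (√s - 1) := by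
    refine ⟨4 * (Y : ℝ) * (unitBallVol (k - 1) / unitBallVol k), ?_, fun s => ?_⟩
    · have h1 := unitBallVol_pos (k - 1)
      have h2 := unitBallVol_pos k
      have h3 : (0 : ℝ) < Y := by exact_mod_cast hY
      positivity
    · rw [eta0]; ring
  obtain ⟨a, ha, hs⟩ := key
  have hex : ∃ s ∈ Ioi (1 : ℝ), eta0 k Y s = 1 := by
    have hD : 0 ≤ (2 + a) ^ 2 - 4 := by nlinarith
    have hq := Real.sq_sqrt hD
    have hq0 := Real.sqrt_nonneg ((2 + a) ^ 2 - 4)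
    set q := √((2 + a) ^ 2 - 4)
    have hu : 1 < (2 + a + q) / 2 := by linarith
    have hu2 : ((2 + a + q) / 2) ^ 2 - (2 + a) * ((2 + a + q) / 2) + 1 = 0 := by nlinarith
    set u := (2 + a + q) / 2
    refine ⟨u ^ 2, ?_, ?_⟩
    · simp only [mem_Ioi]; nlinarith
    · rw [hs, Real.sqrt_sq (by linarith)]
      have h1 : u ≠ 0 := by linarith
      have h2 : u - 1 ≠ 0 := by linarith
      field_simp
      nlinarith
  have hanti : ∀ s t : ℝ, 1 < s → s < t → eta0 k Y t < eta0 k Y s := by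
    intro s t h1 hst
    rw [hs, hs]
    have hs1 : 1 < √s := by
      rw [show (1 : ℝ) = √1 by simp]; exact Real.sqrt_lt_sqrt zero_le_one h1
    have hst' : √s < √t := Real.sqrt_lt_sqrt (by linarith) hst
    have h2 : 1 / √t < 1 / √s := one_div_lt_one_div_of_lt (by linarith) hst'
    have h3 : a / (√t - 1) < a / (√s - 1) :=
      div_lt_div_of_pos_left ha (by linarith) (by linarith)
    linarith
  have hm := Function.invFunOn_mem hex
  have he := Function.invFunOn_eq hex
  refine ⟨hm, he, fun s h1 h2 => ?_⟩
  have he' : eta0 k Y (threshold k Y) = 1 := he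
  have hm' : 1 < threshold k Y := hm
  rcases lt_trichotomy s (threshold k Y) with h | h | h
  · have := hanti _ _ h1 h; linarith
  · exact h
  · have := hanti _ _ hm' h; linarith

end

/-!
The branch `T_j^θ` shifts the coordinates, dividing them by `γ`, and puts
`γ^{k-1} (Φ₀ ∘ Γ + const)` in the last place. The whole theorem rests on one estimate,
`sqrt_mul_dist_le_dist_branch`: on the convex box `Ω_β` every branch expands all distances by at
least `√σ`. By the mean value theorem the squared length of an image segment is
`C₁ σ ∑_{i ≥ 1} w_i² + γ^{2(k-1)} (∂₀Φ₀ w_0 + S)²`, with coordinates counted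
from zero and `S` the part of the later partial derivatives, and the two bounds on the partial
derivatives, fed into `(a + b)² ≥ a² / C₂ - b² / (C₂ - 1)`, make this at least `σ ‖w‖²`. Expansion gives
injectivity, invertible derivatives, smooth inverses contracting by `1/√σ`, and the covering of a
ball of definite radius. The derivative of a branch depends neither on `θ` nor on `j`, so all
constants are uniform; the distortion bound is the Lipschitz continuity of `(det DT)⁻¹` on a compact
convex box. The complement of the pieces is made of faces and of level sets of `Φ₀ ∘ Γ`, which the
branches map into hyperplanes, hence it is null.

For the geometric constant, the preimage of the `ε`-neighbourhood of `∂ T_j(U_j)` lies in the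
`s`-neighbourhood of `∂ U_j` with `s = ε/√σ`, by expansion. Inside a small ball `B(x, ρ)` there are
at most `k` faces and one level set of `Φ₀ ∘ Γ`, separating two pieces. Points in the neighbourhoods
belonging to both pieces are `s`-close to the level set by the intermediate value theorem, so the
sum over `j` counts the neighbourhood of the level set twice and that of each face once
(`tsum_volume_boundary_le`): this is the number `k + 2`. Each neighbourhood is thin in one
direction, so Fubini (`volume_le_of_thin`) bounds its volume by `γ_{k-1} ρ^{k-1} · 2s`, up to a
factor `R` for the level set that tends to `1` with the radius, as the gradient of `Φ₀ ∘ Γ` is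
Lipschitz and bounded away from zero. Since `η₀(σ) < 1` strictly, some `R > 1` is affordable.
-/

/-! ### Expanding maps -/

section Expanding

theorem injOn_of_expanding {X : Type*} [MetricSpace X] {T : X → X} {V : Set X} {c : ℝ} (hc : 0 < c)
    (hT : ∀ u ∈ V, ∀ v ∈ V, c * dist u v ≤ dist (T u) (T v)) : InjOn T V := by
  intro u hu v hv huv
  have := hT u hu v hv
  rw [huv, dist_self] at this
  exact dist_le_zero.1 (nonpos_of_mul_nonpos_right this hc)

theorem eventually_invFunOn_apply {X : Type*} [TopologicalSpace X] {T : X → X} {V : Set X}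
    (hV : IsOpen V) (hinj : InjOn T V) {x : X} (hx : x ∈ V) :
    have : Nonempty X := ⟨x⟩
    ∀ᶠ p in nhds x, Function.invFunOn T V (T p) = p := by
  have : Nonempty X := ⟨x⟩
  filter_upwards [hV.mem_nhds hx] with p hp using hinj.leftInvOn_invFunOn hp

variable {E : Type*} [NormedAddCommGroup E] [NormedSpace ℝ E] {T : E → E} {V : Set E} {c : ℝ}

/-- The derivative inherits the expansion, as a limit of difference quotients. -/
theorem mul_norm_le_norm_of_hasFDerivAt (hV : IsOpen V)
    (hT : ∀ u ∈ V, ∀ v ∈ V, c * dist u v ≤ dist (T u) (T v)) {x : E} (hx : x ∈ V)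
    {T' : E →L[ℝ] E} (hT' : HasFDerivAt T T' x) (w : E) : c * ‖w‖ ≤ ‖T' w‖ := by
  have h1 := (hT'.hasLineDerivAt w).tendsto_slope_zero.norm
  refine ge_of_tendsto h1 ?_
  have h2 : ∀ᶠ t : ℝ in nhds 0, x + t • w ∈ V := by
    have : ContinuousAt (fun t : ℝ => x + t • w) 0 := by fun_prop
    refine this.eventually_mem (hV.mem_nhds ?_)
    simpa using hx
  filter_upwards [nhdsWithin_le_nhds h2, self_mem_nhdsWithin] with t ht ht0
  have h3 := hT _ ht _ hx
  rw [dist_eq_norm, dist_eq_norm, add_sub_cancel_left, norm_smul] at h3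
  have ht0' : 0 < ‖t‖ := norm_pos_iff.2 ht0
  rw [norm_smul, norm_inv, ← div_eq_inv_mul, le_div_iff₀ ht0']
  linarith

variable [FiniteDimensional ℝ E]

theorem exists_equiv_hasStrictFDerivAt (hV : IsOpen V) (hc : 0 < c)
    (hT : ∀ u ∈ V, ∀ v ∈ V, c * dist u v ≤ dist (T u) (T v)) (hC : ContDiffOn ℝ 2 T V)
    {x : E} (hx : x ∈ V) :
    ∃ e : E ≃L[ℝ] E, (e : E →L[ℝ] E) = fderiv ℝ T x ∧
      HasStrictFDerivAt T (e : E →L[ℝ] E) x := by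
  have h1 : ContDiffAt ℝ 2 T x := hC.contDiffAt (hV.mem_nhds hx)
  have h2 := h1.hasStrictFDerivAt (by norm_num)
  have hinj : Function.Injective (fderiv ℝ T x : E →ₗ[ℝ] E) := by
    rw [← LinearMap.ker_eq_bot, LinearMap.ker_eq_bot']
    intro w hw
    have := mul_norm_le_norm_of_hasFDerivAt hV hT hx h2.hasFDerivAt w
    rw [show fderiv ℝ T x w = 0 from hw, norm_zero] at this
    exact norm_le_zero_iff.1 (nonpos_of_mul_nonpos_right this hc)
  let e := (LinearEquiv.ofInjectiveEndo (fderiv ℝ T x : E →ₗ[ℝ] E) hinj).toContinuousLinearEquiv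
  have he : (e : E →L[ℝ] E) = fderiv ℝ T x := by ext w; rfl
  exact ⟨e, he, he ▸ h2⟩

theorem isOpen_image_of_expanding (hV : IsOpen V) (hc : 0 < c)
    (hT : ∀ u ∈ V, ∀ v ∈ V, c * dist u v ≤ dist (T u) (T v)) (hC : ContDiffOn ℝ 2 T V)
    {U : Set E} (hU : IsOpen U) (hUV : U ⊆ V) : IsOpen (T '' U) := by
  rw [isOpen_iff_mem_nhds]
  rintro _ ⟨x, hx, rfl⟩
  obtain ⟨e, -, he⟩ := exists_equiv_hasStrictFDerivAt hV hc hT hC (hUV hx)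
  rw [← he.map_nhds_eq_of_equiv]
  exact Filter.image_mem_map (hU.mem_nhds hx)

theorem contDiffOn_invFunOn_of_expanding (hV : IsOpen V) (hc : 0 < c)
    (hT : ∀ u ∈ V, ∀ v ∈ V, c * dist u v ≤ dist (T u) (T v)) (hC : ContDiffOn ℝ 2 T V) :
    ContDiffOn ℝ 2 (Function.invFunOn T V) (T '' V) := by
  rintro _ ⟨x, hx, rfl⟩
  obtain ⟨e, -, he⟩ := exists_equiv_hasStrictFDerivAt hV hc hT hC hx
  have h1 : ContDiffAt ℝ 2 T x := hC.contDiffAt (hV.mem_nhds hx)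
  have h2 := h1.to_localInverse he.hasFDerivAt (by norm_num)
  refine (h2.congr_of_eventuallyEq ?_).contDiffWithinAt
  exact (h1.hasStrictFDerivAt' he.hasFDerivAt (by norm_num)).localInverse_unique
    (eventually_invFunOn_apply hV (injOn_of_expanding hc hT) hx)

theorem det_fderiv_invFunOn_of_expanding (hV : IsOpen V) (hc : 0 < c)
    (hT : ∀ u ∈ V, ∀ v ∈ V, c * dist u v ≤ dist (T u) (T v)) (hC : ContDiffOn ℝ 2 T V)
    {x : E} (hx : x ∈ V) :
    (fderiv ℝ (Function.invFunOn T V) (T x)).det = ((fderiv ℝ T x).det)⁻¹ := by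
  obtain ⟨e, he', he⟩ := exists_equiv_hasStrictFDerivAt hV hc hT hC hx
  rw [(he.to_local_left_inverse
    (eventually_invFunOn_apply hV (injOn_of_expanding hc hT) hx)).hasFDerivAt.fderiv, ← he']
  exact e.det_coe_symm

theorem det_fderiv_ne_zero_of_expanding (hV : IsOpen V) (hc : 0 < c)
    (hT : ∀ u ∈ V, ∀ v ∈ V, c * dist u v ≤ dist (T u) (T v)) (hC : ContDiffOn ℝ 2 T V)
    {x : E} (hx : x ∈ V) : (fderiv ℝ T x).det ≠ 0 := by
  obtain ⟨e, he, -⟩ := exists_equiv_hasStrictFDerivAt hV hc hT hC hx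
  rw [← he]
  exact (LinearEquiv.isUnit_det' e.toLinearEquiv).ne_zero

/-- An expanding map with open image covers a definite ball: the distance to a target point,
minimised over a closed ball, is too large on the sphere, so the minimum is attained inside, where
openness forces it to be zero. -/
theorem ball_subset_image_closedBall_of_expanding (hV : IsOpen V) (hc : 0 < c)
    (hT : ∀ u ∈ V, ∀ v ∈ V, c * dist u v ≤ dist (T u) (T v)) (hC : ContDiffOn ℝ 2 T V)
    {x : E} {r : ℝ} (hr : 0 < r) (hB : Metric.closedBall x r ⊆ V) :
    Metric.ball (T x) (c * r / 2) ⊆ T '' Metric.closedBall x r := by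
  intro y hy
  have hxV : x ∈ V := hB (Metric.mem_closedBall_self hr.le)
  have hcont : ContinuousOn (fun p => dist (T p) y) (Metric.closedBall x r) :=
    continuous_dist.comp_continuousOn ((hC.continuousOn.mono hB).prodMk continuousOn_const)
  obtain ⟨p, hp, hmin⟩ := (isCompact_closedBall x r).exists_isMinOn
    ⟨x, Metric.mem_closedBall_self hr.le⟩ hcont
  have hpx : dist (T p) y ≤ dist (T x) y := hmin (Metric.mem_closedBall_self hr.le)
  have hy' : dist (T x) y < c * r / 2 := by rw [dist_comm]; exact hy
  have hpr : dist p x < r := by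
    have h1 := hT p (hB hp) x hxV
    have h2 := dist_triangle_right (T p) (T x) y
    have h3 : c * dist p x < c * r := by linarith
    exact lt_of_mul_lt_mul_left h3 hc.le
  refine ⟨p, hp, ?_⟩
  have hopen : IsOpen (T '' Metric.ball x r) := isOpen_image_of_expanding hV hc hT hC
    Metric.isOpen_ball (Metric.ball_subset_closedBall.trans hB)
  by_contra hne
  -- move from `T p` towards `y` inside the open image
  have hcontl : ContinuousAt (fun t : ℝ => T p + t • (y - T p)) 0 := by fun_prop
  have hev : ∀ᶠ t : ℝ in nhds 0, T p + t • (y - T p) ∈ T '' Metric.ball x r := by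
    refine hcontl.eventually_mem (hopen.mem_nhds ?_)
    simpa using ⟨p, hpr, rfl⟩
  obtain ⟨η, hη, hball⟩ := Metric.eventually_nhds_iff.1 hev
  set t := min (η / 2) 1
  have ht0 : 0 < t := by positivity
  have ht1 : t ≤ 1 := min_le_right _ _
  obtain ⟨q, hq, hqe⟩ := hball (y := t) (by
    rw [Real.dist_eq, sub_zero, abs_of_pos ht0]
    exact (min_le_left _ _).trans_lt (by linarith))
  have h1 : dist (T p) y ≤ dist (T q) y := hmin (Metric.ball_subset_closedBall hq)
  rw [hqe, dist_eq_norm, dist_eq_norm,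
    show T p + t • (y - T p) - y = (1 - t) • (T p - y) by module, norm_smul,
    Real.norm_of_nonneg (by linarith)] at h1
  have h2 : 0 < ‖T p - y‖ := norm_pos_iff.2 (sub_ne_zero.2 hne)
  nlinarith

theorem frontier_image_subset_of_expanding (hV : IsOpen V) (hc : 0 < c)
    (hT : ∀ u ∈ V, ∀ v ∈ V, c * dist u v ≤ dist (T u) (T v)) (hC : ContDiffOn ℝ 2 T V)
    {U : Set E} (hU : IsOpen U) (hcomp : IsCompact (closure U)) (hUV : closure U ⊆ V) :
    frontier (T '' U) ⊆ T '' (closure U \ U) := by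
  rw [(isOpen_image_of_expanding hV hc hT hC hU (subset_closure.trans hUV)).frontier_eq]
  rintro w ⟨hw, hw'⟩
  have h1 : closure (T '' U) ⊆ T '' closure U :=
    closure_minimal (image_mono subset_closure)
      (hcomp.image_of_continuousOn (hC.continuousOn.mono hUV)).isClosed
  obtain ⟨q, hq, rfl⟩ := h1 hw
  exact ⟨q, ⟨hq, fun h => hw' ⟨q, h, rfl⟩⟩, rfl⟩

end Expanding

/-! ### Volume of thin sets -/

/-- The identification `ℝ × ℝ^n = ℝ^{n+1}` that prepends a coordinate. -/
noncomputable def prepend (n : ℕ) (q : ℝ × Euc n) : Euc (n + 1) := WithLp.toLp 2 (Fin.cons q.1 q.2)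

theorem measurePreserving_prepend (n : ℕ) : MeasurePreserving (prepend n) := by
  have h1 := PiLp.volume_preserving_toLp (Fin (n + 1))
  have h2 := (volume_preserving_piFinSuccAbove (fun _ : Fin (n + 1) => ℝ) 0).symm
  have h3 : MeasurePreserving (Prod.map id WithLp.ofLp : ℝ × Euc n → ℝ × (Fin n → ℝ)) :=
    (MeasurePreserving.id volume).prod (PiLp.volume_preserving_ofLp (Fin n))
  convert (h1.comp h2).comp h3 using 1
  ext q i
  simp [prepend, MeasurableEquiv.piFinSuccAbove]

theorem prepend_add_single {n : ℕ} (s t : ℝ) (y : Euc n) :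
    prepend n (s, y) + t • EuclideanSpace.single 0 1 = prepend n (s + t, y) := by
  ext i
  refine Fin.cases ?_ (fun j => ?_) i <;> simp [prepend]

theorem dist_tail_le_dist_prepend {n : ℕ} (s : ℝ) (y : Euc n) (x : Euc (n + 1)) :
    dist y (WithLp.toLp 2 (fun i => x i.succ)) ≤ dist (prepend n (s, y)) x := by
  rw [EuclideanSpace.dist_eq, EuclideanSpace.dist_eq]
  refine Real.sqrt_le_sqrt ?_
  rw [Fin.sum_univ_succ]
  simp only [prepend, Fin.cons_succ]
  exact le_add_of_nonneg_left (sq_nonneg _)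

theorem volume_ball_eq_unitBallVol (n : ℕ) (x : Euc n) {ρ : ℝ} (hρ : 0 < ρ) :
    volume (Metric.ball x ρ) = ENNReal.ofReal (unitBallVol n * ρ ^ n) := by
  rw [Measure.addHaar_ball_of_pos volume x hρ, mul_comm, unitBallVol,
    ENNReal.ofReal_mul ENNReal.toReal_nonneg, ENNReal.ofReal_toReal measure_ball_lt_top.ne]
  simp

theorem volume_le_of_thin_first {n : ℕ} {A : Set (Euc (n + 1))} (hA : MeasurableSet A)
    {x : Euc (n + 1)} {ρ ℓ : ℝ} (hρ : 0 < ρ) (hAρ : A ⊆ Metric.ball x ρ)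
    (hthin : ∀ p ∈ A, ∀ t : ℝ, p + t • EuclideanSpace.single 0 1 ∈ A → |t| ≤ ℓ) :
    volume A ≤ ENNReal.ofReal (unitBallVol n * ρ ^ n * ℓ) := by
  have hmp := measurePreserving_prepend n
  set x' : Euc n := WithLp.toLp 2 (fun i => x i.succ)
  rw [← hmp.measure_preimage hA.nullMeasurableSet, Measure.volume_eq_prod,
    Measure.prod_apply_symm (hmp.measurable hA)]
  calc ∫⁻ y, volume ((fun s => (s, y)) ⁻¹' (prepend n ⁻¹' A))
      ≤ ∫⁻ y, (Metric.ball x' ρ).indicator (fun _ => ENNReal.ofReal ℓ) y := by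
        refine lintegral_mono fun y => ?_
        by_cases hy : y ∈ Metric.ball x' ρ
        · rw [indicator_of_mem hy]
          refine (Real.volume_le_diam _).trans (Metric.ediam_le fun s hs t ht => ?_)
          rw [edist_dist]
          refine ENNReal.ofReal_le_ofReal ?_
          rw [dist_comm, Real.dist_eq]
          refine hthin _ hs (t - s) ?_
          rw [prepend_add_single, add_sub_cancel]
          exact ht
        · rw [indicator_of_notMem hy]
          have : (fun s => (s, y)) ⁻¹' (prepend n ⁻¹' A) = ∅ := by
            refine eq_empty_of_forall_notMem fun s hs => hy ?_
            exact (dist_tail_le_dist_prepend s y x).trans_lt (hAρ hs)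
          rw [this, measure_empty]
    _ = ENNReal.ofReal (unitBallVol n * ρ ^ n * ℓ) := by
        rw [lintegral_indicator_const Metric.isOpen_ball.measurableSet,
          volume_ball_eq_unitBallVol n x' hρ, mul_comm,
          ENNReal.ofReal_mul (mul_nonneg (unitBallVol_pos n).le (by positivity))]

/-- A measurable subset of a ball of radius `ρ` that meets every line of a given direction in a set
of diameter at most `ℓ` has volume at most `γ_n ρ^n ℓ`: by Fubini, as its projection along that
direction lies in an `n`-dimensional ball of radius `ρ`. -/
theorem volume_le_of_thin {n : ℕ} {A : Set (Euc (n + 1))} (hA : MeasurableSet A)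
    {x v : Euc (n + 1)} {ρ ℓ : ℝ} (hρ : 0 < ρ) (hAρ : A ⊆ Metric.ball x ρ) (hv : ‖v‖ = 1)
    (hthin : ∀ p ∈ A, ∀ t : ℝ, p + t • v ∈ A → |t| ≤ ℓ) :
    volume A ≤ ENNReal.ofReal (unitBallVol n * ρ ^ n * ℓ) := by
  have h1 : Orthonormal ℝ (({0} : Set (Fin (n + 1))).domRestrict fun _ => v) := by
    refine ⟨fun _ => hv, fun i j hij => ?_⟩
    exact absurd (Subsingleton.elim i j) hij
  obtain ⟨b, hb⟩ := h1.exists_orthonormalBasis_extension_of_card_eq (by simp)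
  have hb0 : b 0 = v := hb 0 rfl
  let e := b.repr
  have hmp : MeasurePreserving e.symm := b.measurePreserving_repr_symm
  have hes : e.symm (EuclideanSpace.single 0 1) = v := by rw [← hb0]; simp [e]
  rw [← hmp.measure_preimage hA.nullMeasurableSet]
  refine volume_le_of_thin_first (hmp.measurable hA) (x := e x) hρ (fun p hp => ?_) ?_
  · have := hAρ hp
    rw [Metric.mem_ball] at this ⊢
    rwa [← e.symm.dist_map, e.symm_apply_apply]
  · intro p hp t ht
    refine hthin _ hp t ?_
    have := mem_preimage.1 ht
    rwa [map_add, map_smul, hes] at this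

/-! ### Boxes and the dilation -/

/-- The dilation `Γ` as a continuous linear map. -/
noncomputable def dilationCLM {k : ℕ} (γ : ℝ) : Euc k →L[ℝ] Euc k :=
  LinearMap.toContinuousLinearMap
    { toFun := dilation γ
      map_add' := fun x y => by ext i; simp [dilation, add_div]
      map_smul' := fun a x => by ext i; simp [dilation, mul_div_assoc] }

theorem dilationCLM_apply {k : ℕ} (γ : ℝ) (x : Euc k) : dilationCLM γ x = dilation γ x := rfl

theorem openCube_eq_iInter (k : ℕ) (r : ℝ) :
    openCube k r = ⋂ i : Fin k, (fun x : Euc k => x i) ⁻¹' Ioo (-r) r := by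
  ext x; simp [openCube]

theorem isOpen_openCube (k : ℕ) (r : ℝ) : IsOpen (openCube k r) := by
  rw [openCube_eq_iInter]
  exact isOpen_iInter_of_finite fun i => isOpen_Ioo.preimage (by fun_prop)

theorem convex_openCube (k : ℕ) (r : ℝ) : Convex ℝ (openCube k r) := by
  rw [openCube_eq_iInter]
  exact convex_iInter fun i => (convex_Ioo _ _).linear_preimage
    (EuclideanSpace.proj i : Euc k →L[ℝ] ℝ).toLinearMap

theorem isOpen_openBox (k : ℕ) (L γ r : ℝ) : IsOpen (openBox k L γ r) :=
  (isOpen_openCube k _).preimage (dilationCLM γ).continuous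

theorem convex_openBox (k : ℕ) (L γ r : ℝ) : Convex ℝ (openBox k L γ r) :=
  (convex_openCube k _).linear_preimage (dilationCLM γ).toLinearMap

theorem mem_openBox_iff {k : ℕ} {L γ r : ℝ} (hγ : 0 < γ) {x : Euc k} :
    x ∈ openBox k L γ r ↔ ∀ i, |x i| < γ ^ (i : ℕ) * (L + r) := by
  refine forall_congr' fun i => ?_
  have h : 0 < γ ^ (i : ℕ) := by positivity
  rw [abs_lt]
  simp only [dilation]
  rw [lt_div_iff₀ h, div_lt_iff₀ h, mul_comm (γ ^ (i : ℕ)), neg_mul]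

/-- The compact box `Γ⁻¹([-L-r, L+r]^k)`. -/
def closedBox (k : ℕ) (L γ r : ℝ) : Set (Euc k) :=
  {x | ∀ i : Fin k, |x i| ≤ γ ^ (i : ℕ) * (L + r)}

theorem box_eq_closedBox (k : ℕ) (L γ : ℝ) : box k L γ = closedBox k L γ 0 := by
  ext x
  simp only [box, closedBox, mem_ofPred_eq, abs_le, add_zero]

theorem closedBox_eq_iInter (k : ℕ) (L γ r : ℝ) :
    closedBox k L γ r = ⋂ i : Fin k, (fun x : Euc k => x i) ⁻¹'
      Icc (-(γ ^ (i : ℕ) * (L + r))) (γ ^ (i : ℕ) * (L + r)) := by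
  ext x; simp [closedBox, abs_le]

theorem convex_closedBox (k : ℕ) (L γ r : ℝ) : Convex ℝ (closedBox k L γ r) := by
  rw [closedBox_eq_iInter]
  exact convex_iInter fun i => (convex_Icc _ _).linear_preimage
    (EuclideanSpace.proj i : Euc k →L[ℝ] ℝ).toLinearMap

theorem isClosed_closedBox (k : ℕ) (L γ r : ℝ) : IsClosed (closedBox k L γ r) := by
  rw [closedBox_eq_iInter]
  exact isClosed_iInter fun i => isClosed_Icc.preimage (by fun_prop)

theorem isCompact_closedBox (k : ℕ) (L γ r : ℝ) : IsCompact (closedBox k L γ r) := by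
  refine Metric.isCompact_of_isClosed_isBounded (isClosed_closedBox k L γ r) ?_
  have h : IsCompact ((EuclideanSpace.equiv (Fin k) ℝ).symm '' (Set.univ.pi fun i : Fin k =>
      Icc (-(γ ^ (i : ℕ) * (L + r))) (γ ^ (i : ℕ) * (L + r)))) :=
    (isCompact_univ_pi fun _ => isCompact_Icc).image (by fun_prop)
  refine h.isBounded.subset fun x hx => ⟨x.ofLp, fun i _ => abs_le.1 (hx i), rfl⟩

theorem openBox_subset_closedBox {k : ℕ} {L γ r : ℝ} (hγ : 0 < γ) :
    openBox k L γ r ⊆ closedBox k L γ r := fun _ hx i => ((mem_openBox_iff hγ).1 hx i).le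

theorem closedBox_subset_openBox {k : ℕ} {L γ r s : ℝ} (hγ : 0 < γ) (hrs : r < s) :
    closedBox k L γ r ⊆ openBox k L γ s := fun _ hx =>
  (mem_openBox_iff hγ).2 fun i => (hx i).trans_lt <| by
    have : 0 < γ ^ (i : ℕ) := by positivity
    gcongr

/-- Moving a point of a box by at most `γ^{k-1} t` in norm changes the size parameter by at most
`t`, provided `γ ≤ 1`. -/
theorem mem_closedBox_of_dist_le {k : ℕ} {L γ r s t : ℝ} (hγ : 0 < γ) (hγ1 : γ ≤ 1) (ht : 0 ≤ t)
    (hst : r + t ≤ s) {x y : Euc k} (hx : x ∈ closedBox k L γ r)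
    (hxy : dist y x ≤ γ ^ (k - 1) * t) : y ∈ closedBox k L γ s := by
  intro i
  have h1 : |y i - x i| ≤ dist y x := by
    rw [dist_eq_norm]
    simpa using PiLp.norm_apply_le (y - x) i
  have h2 : γ ^ (k - 1) ≤ γ ^ (i : ℕ) :=
    pow_le_pow_of_le_one hγ.le hγ1 (by have := i.2; omega)
  have h3 := hx i
  have h4 : |y i| ≤ |y i - x i| + |x i| := by simpa using abs_add_le (y i - x i) (x i)
  have h5 : γ ^ (k - 1) * t ≤ γ ^ (i : ℕ) * t := by gcongr
  have h6 : γ ^ (i : ℕ) * (L + r) + γ ^ (i : ℕ) * t ≤ γ ^ (i : ℕ) * (L + s) := by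
    rw [← mul_add]
    exact mul_le_mul_of_nonneg_left (by linarith) (by positivity)
  exact (h4.trans (add_le_add (h1.trans (hxy.trans h5)) h3)).trans (by linarith)

/-! ### The pulled back function and the branches -/

/-- The function `Φ₀ ∘ Γ`. -/
noncomputable def pulled {k : ℕ} (Φ₀ : Euc k → ℝ) (γ : ℝ) (u : Euc k) : ℝ := Φ₀ (dilation γ u)

section Branch

variable {k : ℕ} {Φ₀ : Euc k → ℝ} {L β γ : ℝ}

theorem contDiffOn_pulled (hΦ₀ : ContDiffOn ℝ 2 Φ₀ (openCube k (L + β))) :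
    ContDiffOn ℝ 2 (pulled Φ₀ γ) (openBox k L γ β) :=
  hΦ₀.comp (dilationCLM γ).contDiff.contDiffOn fun _ hx => hx

theorem fderiv_pulled_apply (hΦ₀ : ContDiffOn ℝ 2 Φ₀ (openCube k (L + β))) {u : Euc k}
    (hu : u ∈ openBox k L γ β) (w : Euc k) :
    fderiv ℝ (pulled Φ₀ γ) u w
      = ∑ i, partialDeriv Φ₀ i (dilation γ u) * (w i / γ ^ (i : ℕ)) := by
  have h1 : DifferentiableAt ℝ Φ₀ (dilationCLM γ u) :=
    (hΦ₀.contDiffAt ((isOpen_openCube k _).mem_nhds hu)).differentiableAt (by norm_num)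
  have h2 : HasFDerivAt (pulled Φ₀ γ) ((fderiv ℝ Φ₀ (dilationCLM γ u)).comp (dilationCLM γ)) u :=
    h1.hasFDerivAt.comp u (dilationCLM γ).hasFDerivAt
  have h3 : dilation γ w = ∑ i, (w i / γ ^ (i : ℕ)) • EuclideanSpace.single i (1 : ℝ) := by
    ext j
    simp [dilation, Finset.sum_apply, Pi.single_apply]
  rw [h2.fderiv, ContinuousLinearMap.comp_apply, dilationCLM_apply, dilationCLM_apply, h3, map_sum]
  refine Finset.sum_congr rfl fun i _ => ?_
  rw [map_smul, smul_eq_mul, mul_comm, partialDeriv]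

theorem shiftMap_castSucc {n : ℕ} (γ : ℝ) (ψ : Euc (n + 1) → ℝ) (u : Euc (n + 1)) (i : Fin n) :
    shiftMap γ ψ u i.castSucc = u i.succ / γ := by
  simp only [shiftMap, Fin.val_castSucc]
  rw [dif_pos (by omega)]
  rfl

theorem shiftMap_last {n : ℕ} (γ : ℝ) (ψ : Euc (n + 1) → ℝ) (u : Euc (n + 1)) :
    shiftMap γ ψ u (Fin.last n) = γ ^ n * ψ (dilation γ u) := by
  simp [shiftMap]

theorem contDiffOn_branch (hΦ₀ : ContDiffOn ℝ 2 Φ₀ (openCube k (L + β))) (θ : ℝ) (j : ℤ) :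
    ContDiffOn ℝ 2 (branch Φ₀ L γ θ j) (openBox k L γ β) := by
  rw [contDiffOn_euclidean]
  intro i
  by_cases h : (i : ℕ) + 1 < k
  · simp only [branch, shiftMap, h, dif_pos]
    fun_prop
  · simp only [branch, shiftMap, h, dif_neg, not_false_eq_true]
    exact contDiffOn_const.mul ((contDiffOn_pulled hΦ₀).add contDiffOn_const)

/-- The branches, for all `θ` and `j`, differ by constant vectors. -/
theorem fderiv_branch_eq (θ : ℝ) (j : ℤ) :
    fderiv ℝ (branch Φ₀ L γ θ j) = fderiv ℝ (branch Φ₀ L γ 0 0) := by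
  have h : branch Φ₀ L γ θ j = fun u => branch Φ₀ L γ 0 0 u +
      WithLp.toLp 2 (fun i : Fin k => if (i : ℕ) + 1 < k then 0
        else γ ^ (k - 1) * (θ - 2 * (j : ℝ) * L)) := by
    funext u
    ext i
    by_cases h : (i : ℕ) + 1 < k
    · simp [branch, shiftMap, h]
    · simp only [branch, shiftMap, h, PiLp.add_apply, dif_neg, not_false_eq_true, if_false]
      simp
      ring
  rw [h]
  funext u
  exact fderiv_add_const _

end Branch

/-! ### Expansion of the branches -/

theorem sq_div_sub_sq_div_le_add_sq {p : ℝ} (hp : 1 < p) (a b : ℝ) :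
    a ^ 2 / p - b ^ 2 / (p - 1) ≤ (a + b) ^ 2 := by
  have h1 : 0 < p := by linarith
  have h2 : 0 < p - 1 := by linarith
  have h3 : (a + b) ^ 2 - (a ^ 2 / p - b ^ 2 / (p - 1))
      = ((p - 1) * a + p * b) ^ 2 / (p * (p - 1)) := by
    field_simp
    ring
  have h4 : 0 ≤ ((p - 1) * a + p * b) ^ 2 / (p * (p - 1)) := by positivity
  linarith

section Expansion

variable {n : ℕ} {Φ₀ : Euc (n + 1) → ℝ} {L β γ σ C₁ C₂ : ℝ}

/-- The branches expand distances by `√σ`. With `w = u - v` and `S` the contribution of the later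
partial derivatives to the mean value formula, `γ^{2n} S² ≤ (C₁ - 1)(C₂ - 1) σ ∑_{i ≥ 1} w_i²`, which
costs at most `(C₁ - 1) σ ∑_{i ≥ 1} w_i²` out of the `C₁ σ ∑_{i ≥ 1} w_i²` gained by the shift. -/
theorem sqrt_mul_dist_le_dist_branch (hn : 1 ≤ n)
    (hΦ₀ : ContDiffOn ℝ 2 Φ₀ (openCube (n + 1) (L + β)))
    (hσ : 1 < σ) (hC₁ : 1 < C₁) (hC₂ : 1 < C₂) (hγ : 0 < γ) (hγσ : γ ^ 2 * (C₁ * σ) = 1)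
    (hfirst : ∀ x ∈ openCube (n + 1) (L + β), C₁ ^ n * C₂ * σ ^ (n + 1) ≤ partialDeriv Φ₀ 0 x ^ 2)
    (hother : ∀ x ∈ openCube (n + 1) (L + β), ∀ i : Fin n,
      partialDeriv Φ₀ i.succ x ^ 2 ≤ (C₁ - 1) * (C₂ - 1) / n * σ)
    (θ : ℝ) (j : ℤ) {u v : Euc (n + 1)} (hu : u ∈ openBox (n + 1) L γ β)
    (hv : v ∈ openBox (n + 1) L γ β) :
    √σ * dist u v ≤ dist (branch Φ₀ L γ θ j u) (branch Φ₀ L γ θ j v) := by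
  have hconv := convex_openBox (n + 1) L γ β
  have hnpos : (0 : ℝ) < n := by exact_mod_cast hn
  obtain ⟨z, hz, hmvt⟩ := domain_mvt (f := pulled Φ₀ γ) (f' := fun x => fderiv ℝ (pulled Φ₀ γ) x)
    (fun x hx => (((contDiffOn_pulled hΦ₀).contDiffAt
      ((isOpen_openBox _ L γ β).mem_nhds hx)).differentiableAt
        (by norm_num)).hasFDerivAt.hasFDerivWithinAt) hconv hv hu
  have hz' : z ∈ openBox (n + 1) L γ β := hconv.segment_subset hv hu hz
  rw [fderiv_pulled_apply hΦ₀ hz', Fin.sum_univ_succ] at hmvt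
  have ha := hfirst _ hz'
  have hb := hother _ hz'
  set y := dilation γ z
  set w := u - v with hw
  set S := ∑ i : Fin n, partialDeriv Φ₀ i.succ y * (w i.succ / γ ^ (i.succ : ℕ)) with hS
  set W := ∑ i : Fin n, w i.succ ^ 2 with hW
  have hγ1 : γ ≤ 1 := by
    by_contra h
    push Not at h
    have h1 : 1 < C₁ * σ := by nlinarith
    nlinarith
  have hSW : γ ^ (2 * n) * S ^ 2 ≤ (C₁ - 1) * (C₂ - 1) * σ * W := by
    have h1 : S ^ 2 ≤ (∑ i : Fin n, partialDeriv Φ₀ i.succ y ^ 2) *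
        ∑ i : Fin n, (w i.succ / γ ^ (i.succ : ℕ)) ^ 2 := Finset.sum_mul_sq_le_sq_mul_sq _ _ _
    have h2 : ∑ i : Fin n, partialDeriv Φ₀ i.succ y ^ 2 ≤ (C₁ - 1) * (C₂ - 1) * σ := by
      refine (Finset.sum_le_sum fun i _ => hb i).trans (le_of_eq ?_)
      rw [Finset.sum_const, Finset.card_univ, Fintype.card_fin, nsmul_eq_mul]
      field_simp
    have h3 : γ ^ (2 * n) * ∑ i : Fin n, (w i.succ / γ ^ (i.succ : ℕ)) ^ 2 ≤ W := by
      rw [Finset.mul_sum]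
      refine Finset.sum_le_sum fun i _ => ?_
      rw [div_pow, ← mul_div_assoc, ← pow_mul]
      rw [div_le_iff₀ (by positivity), mul_comm]
      have : γ ^ (2 * n) ≤ γ ^ ((i.succ : ℕ) * 2) :=
        pow_le_pow_of_le_one hγ.le hγ1 (by rw [Fin.val_succ]; omega)
      gcongr
    calc γ ^ (2 * n) * S ^ 2
        ≤ γ ^ (2 * n) * ((∑ i : Fin n, partialDeriv Φ₀ i.succ y ^ 2) *
          ∑ i : Fin n, (w i.succ / γ ^ (i.succ : ℕ)) ^ 2) := by gcongr
      _ = (∑ i : Fin n, partialDeriv Φ₀ i.succ y ^ 2) *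
          (γ ^ (2 * n) * ∑ i : Fin n, (w i.succ / γ ^ (i.succ : ℕ)) ^ 2) := by ring
      _ ≤ (C₁ - 1) * (C₂ - 1) * σ * W := by
          refine mul_le_mul h2 h3 (by positivity) ?_
          have : 0 < C₁ - 1 := by linarith
          have : 0 < C₂ - 1 := by linarith
          positivity
  have hpow : γ ^ (2 * n) * (C₁ ^ n * σ ^ n) = 1 := by
    rw [pow_mul, ← mul_pow, ← mul_pow, hγσ, one_pow]
  have hA : σ * w 0 ^ 2 ≤ γ ^ (2 * n) * ((partialDeriv Φ₀ 0 y * w 0) ^ 2 / C₂) := by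
    have h1 : σ * w 0 ^ 2 = γ ^ (2 * n) * ((C₁ ^ n * C₂ * σ ^ (n + 1)) * w 0 ^ 2 / C₂) := by
      have : C₂ ≠ 0 := by linarith
      field_simp
      rw [pow_succ]
      linear_combination (-(w 0 ^ 2 * σ)) * hpow
    rw [h1, mul_pow]
    gcongr
  have hB : γ ^ (2 * n) * (S ^ 2 / (C₂ - 1)) ≤ (C₁ - 1) * σ * W := by
    have : 0 < C₂ - 1 := by linarith
    rw [← mul_div_assoc, div_le_iff₀ this]
    linarith
  have hAB : σ * w 0 ^ 2 - (C₁ - 1) * σ * W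
      ≤ γ ^ (2 * n) * (partialDeriv Φ₀ 0 y * w 0 + S) ^ 2 := by
    have h1 := mul_le_mul_of_nonneg_left
      (sq_div_sub_sq_div_le_add_sq hC₂ (partialDeriv Φ₀ 0 y * w 0) S)
      (show 0 ≤ γ ^ (2 * n) by positivity)
    rw [mul_sub] at h1
    linarith
  have hdist : dist (branch Φ₀ L γ θ j u) (branch Φ₀ L γ θ j v) ^ 2
      = C₁ * σ * W + γ ^ (2 * n) * (partialDeriv Φ₀ 0 y * w 0 + S) ^ 2 := by
    rw [EuclideanSpace.dist_eq, Real.sq_sqrt (by positivity), Fin.sum_univ_castSucc]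
    congr 1
    · rw [hW, Finset.mul_sum]
      refine Finset.sum_congr rfl fun i _ => ?_
      rw [branch, shiftMap_castSucc, shiftMap_castSucc, Real.dist_eq, sq_abs, ← sub_div, div_pow,
        div_eq_iff (by positivity), hw, PiLp.sub_apply]
      linear_combination (-(u i.succ - v i.succ) ^ 2) * hγσ
    · rw [branch, shiftMap_last, shiftMap_last, Real.dist_eq, sq_abs]
      have h1 : Φ₀ (dilation γ u) - Φ₀ (dilation γ v) = partialDeriv Φ₀ 0 y * w 0 + S := by
        have h2 : pulled Φ₀ γ u - pulled Φ₀ γ v = _ := hmvt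
        simpa [pulled] using h2
      rw [← h1]
      ring
  have hdist' : dist u v ^ 2 = w 0 ^ 2 + W := by
    rw [EuclideanSpace.dist_eq, Real.sq_sqrt (by positivity), Fin.sum_univ_succ]
    simp only [Real.dist_eq, sq_abs, hw, hW, PiLp.sub_apply]
  refine abs_le_of_sq_le_sq' ?_ dist_nonneg |>.2
  rw [mul_pow, Real.sq_sqrt (by linarith), hdist, hdist']
  linarith

theorem le_norm_fderiv_pulled (hΦ₀ : ContDiffOn ℝ 2 Φ₀ (openCube (n + 1) (L + β))) {M : ℝ}
    (hfirst : ∀ x ∈ openCube (n + 1) (L + β), M ≤ partialDeriv Φ₀ 0 x ^ 2)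
    {u : Euc (n + 1)} (hu : u ∈ openBox (n + 1) L γ β) :
    √M ≤ ‖fderiv ℝ (pulled Φ₀ γ) u‖ := by
  have h1 := (fderiv ℝ (pulled Φ₀ γ) u).le_opNorm (EuclideanSpace.single 0 1)
  rw [fderiv_pulled_apply hΦ₀ hu, Fin.sum_univ_succ] at h1
  have h2 : √M ≤ |partialDeriv Φ₀ 0 (dilation γ u)| :=
    Real.sqrt_le_iff.2 ⟨abs_nonneg _, by rw [sq_abs]; exact hfirst _ hu⟩
  simp at h1
  linarith

end Expansion

/-! ### Neighbourhoods of level sets and of faces -/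

section Slabs

variable {n : ℕ} {f : Euc (n + 1) → ℝ} {x : Euc (n + 1)} {ρ r s ω : ℝ}

theorem exists_norm_eq_one_apply_eq_norm {E : Type*} [NormedAddCommGroup E] [InnerProductSpace ℝ E]
    [CompleteSpace E] (φ : E →L[ℝ] ℝ) (hφ : φ ≠ 0) : ∃ v : E, ‖v‖ = 1 ∧ φ v = ‖φ‖ := by
  set g := (InnerProductSpace.toDual ℝ E).symm φ with hg
  have hgn : ‖g‖ = ‖φ‖ := LinearIsometryEquiv.norm_map _ _
  have h0 : ‖g‖ ≠ 0 := by rw [hgn]; exact norm_ne_zero_iff.2 hφ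
  refine ⟨‖g‖⁻¹ • g, by rw [norm_smul, norm_inv, norm_norm, inv_mul_cancel₀ h0], ?_⟩
  have h1 : φ g = ‖g‖ ^ 2 := by
    rw [← real_inner_self_eq_norm_sq]
    exact (InnerProductSpace.toDual_symm_apply (𝕜 := ℝ)).symm
  rw [map_smul, h1, smul_eq_mul, ← hgn]
  field_simp

theorem abs_sub_le_of_fderiv_close (hd : ∀ p ∈ Metric.ball x r, DifferentiableAt ℝ f p)
    (hω : ∀ p ∈ Metric.ball x r, ‖fderiv ℝ f p - fderiv ℝ f x‖ ≤ ω)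
    {p q : Euc (n + 1)} (hp : p ∈ Metric.ball x r) (hq : q ∈ Metric.ball x r) :
    |f p - f q| ≤ (‖fderiv ℝ f x‖ + ω) * dist p q := by
  rw [dist_eq_norm]
  refine (convex_ball x r).norm_image_sub_le_of_norm_fderiv_le hd (fun y hy => ?_) hq hp
  have h1 := hω y hy
  have h2 := norm_add_le (fderiv ℝ f y - fderiv ℝ f x) (fderiv ℝ f x)
  rw [sub_add_cancel] at h2
  linarith

/-- The neighbourhood `|f - c| < h` of a level set of a function with nearly constant derivative has
at most the volume of a slightly thicker flat slab: along the direction of the gradient the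
function grows with slope at least `‖Df(x)‖ - ω`. -/
theorem volume_levelSlab_le (hd : ∀ p ∈ Metric.ball x ρ, DifferentiableAt ℝ f p)
    (hω : ∀ p ∈ Metric.ball x ρ, ‖fderiv ℝ f p - fderiv ℝ f x‖ ≤ ω)
    (hρ : 0 < ρ) (hlt : ω < ‖fderiv ℝ f x‖) (c h : ℝ) :
    volume {p ∈ Metric.ball x ρ | |f p - c| < h} ≤
      ENNReal.ofReal (unitBallVol n * ρ ^ n * (2 * h / (‖fderiv ℝ f x‖ - ω))) := by
  have hω0 : 0 ≤ ω := (norm_nonneg _).trans (hω x (Metric.mem_ball_self hρ))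
  obtain ⟨v, hv, hv'⟩ := exists_norm_eq_one_apply_eq_norm (fderiv ℝ f x)
    (norm_ne_zero_iff.1 (by linarith))
  have hmeas : MeasurableSet {p ∈ Metric.ball x ρ | |f p - c| < h} := by
    have hc : ContinuousOn (fun p => |f p - c|) (Metric.ball x ρ) := fun p hp =>
      ((hd p hp).continuousAt.sub continuousAt_const).abs.continuousWithinAt
    exact (hc.isOpen_inter_preimage Metric.isOpen_ball isOpen_Iio).measurableSet
  refine volume_le_of_thin hmeas hρ (fun p hp => hp.1) hv fun p hp t ht => ?_
  have h1 := (convex_ball x ρ).norm_image_sub_le_of_norm_fderiv_le' hd hω hp.1 ht.1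
  rw [add_sub_cancel_left, map_smul, hv', smul_eq_mul, norm_smul, hv, mul_one, Real.norm_eq_abs,
    Real.norm_eq_abs] at h1
  have h2 := hp.2
  have h3 := ht.2
  have h4 : |t * ‖fderiv ℝ f x‖| = |t| * ‖fderiv ℝ f x‖ := by
    rw [abs_mul, abs_of_nonneg (norm_nonneg _)]
  have h5 : |t * ‖fderiv ℝ f x‖| ≤
      |f (p + t • v) - f p - t * ‖fderiv ℝ f x‖| + |f (p + t • v) - c| + |f p - c| := by
    have h51 := abs_add_le (-(f (p + t • v) - f p - t * ‖fderiv ℝ f x‖)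
      + (f (p + t • v) - c)) (-(f p - c))
    have h52 := abs_add_le (-(f (p + t • v) - f p - t * ‖fderiv ℝ f x‖)) (f (p + t • v) - c)
    rw [abs_neg] at h51 h52
    rw [show -(f (p + t • v) - f p - t * ‖fderiv ℝ f x‖) + (f (p + t • v) - c) + -(f p - c)
      = t * ‖fderiv ℝ f x‖ by ring] at h51
    linarith
  rw [le_div_iff₀ (by linarith)]
  linarith

/-- The `s`-neighbourhood of the pair of faces `x_i = ±a`; the ball is too small to meet both. -/
theorem volume_faceSlab_le {a : ℝ} (i : Fin (n + 1)) (hρ : 0 < ρ) (ha : ρ + s ≤ a) :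
    volume {p ∈ Metric.ball x ρ | |(|p i| - a)| < s} ≤
      ENNReal.ofReal (unitBallVol n * ρ ^ n * (2 * s)) := by
  have hmeas : MeasurableSet {p ∈ Metric.ball x ρ | |(|p i| - a)| < s} := by
    have hc : Continuous fun p : Euc (n + 1) => |(|p i| - a)| := by fun_prop
    exact (Metric.isOpen_ball.inter (isOpen_lt hc continuous_const)).measurableSet
  refine volume_le_of_thin (v := EuclideanSpace.single i 1) hmeas hρ (fun p hp => hp.1) (by simp)
    fun p hp t ht => ?_
  have h1 : |t| < 2 * ρ := by
    have h2 := dist_triangle_right (p + t • EuclideanSpace.single i 1) p x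
    have h3 : dist (p + t • EuclideanSpace.single i 1) p = |t| := by
      rw [dist_eq_norm, add_sub_cancel_left, norm_smul]
      simp
    have h4 := Metric.mem_ball.1 hp.1
    have h5 := Metric.mem_ball.1 ht.1
    linarith
  have h6 := hp.2
  have h7 := ht.2
  simp only [PiLp.add_apply, PiLp.smul_apply, PiLp.single_apply, if_true, smul_eq_mul,
    mul_one] at h7
  rw [abs_lt] at h6 h7 h1
  rw [abs_le]
  rcases abs_cases (p i) with h8 | h8 <;> rcases abs_cases (p i + t) with h9 | h9 <;>
    constructor <;> linarith

theorem tsum_volume_le_of_two {E : ℤ → Set (Euc (n + 1))} {W F : Set (Euc (n + 1))} {m : ℤ}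
    (hmeas : ∀ j, MeasurableSet (E j))
    (hE : ∀ j, (E j).Nonempty → j = m ∨ j = m + 1)
    (h1 : ∀ j, E j ⊆ W ∪ F) (h2 : E m ∩ E (m + 1) ⊆ W) :
    ∑' j, volume (E j) ≤ 2 * volume W + volume F := by
  have hz : ∀ j ∉ ({m, m + 1} : Finset ℤ), volume (E j) = 0 := by
    intro j hj
    rw [Finset.mem_insert, Finset.mem_singleton] at hj
    rcases (E j).eq_empty_or_nonempty with h | h
    · rw [h, measure_empty]
    · exact absurd (hE j h) hj
  rw [tsum_eq_sum hz, Finset.sum_pair (by omega), ← measure_union_add_inter _ (hmeas (m + 1))]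
  calc volume (E m ∪ E (m + 1)) + volume (E m ∩ E (m + 1))
      ≤ volume (W ∪ F) + volume W :=
        add_le_add (measure_mono (union_subset (h1 _) (h1 _))) (measure_mono h2)
    _ ≤ (volume W + volume F) + volume W := by gcongr; exact measure_union_le _ _
    _ = 2 * volume W + volume F := by ring

/-- The counting argument behind the crossing number `k + 2`. In a small ball only the two pieces
adjacent to one level `c` are present. A point in the boundary neighbourhoods of both is close to
points on both sides of the level set, hence, by the intermediate value theorem on a ball, to the
level set itself. So only the neighbourhood `W` of the level set is counted twice, and those of the
faces are counted once. -/
theorem tsum_volume_boundary_le {L θ : ℝ} (hL : 0 < L) {a : Fin (n + 1) → ℝ}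
    (hρ : 0 < ρ) (hs : 0 < s)
    (hd : ∀ p ∈ Metric.ball x (ρ + s), DifferentiableAt ℝ f p)
    (hω : ∀ p ∈ Metric.ball x (ρ + s), ‖fderiv ℝ f p - fderiv ℝ f x‖ ≤ ω)
    (hlt : ω < ‖fderiv ℝ f x‖)
    (hosc : ∀ p ∈ Metric.ball x (ρ + s), |f p - f x| ≤ L / 2)
    (ha : ∀ i, ρ + s ≤ a i) {E : ℤ → Set (Euc (n + 1))} (hmeas : ∀ j, MeasurableSet (E j))
    (hball : ∀ j, E j ⊆ Metric.ball x ρ)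
    (hE : ∀ j, ∀ p ∈ E j, ∃ q, dist q p < s ∧ (2 * (j : ℝ) - 1) * L ≤ θ + f q ∧
      θ + f q ≤ (2 * (j : ℝ) + 1) * L ∧ ((∃ i, |q i| = a i) ∨ θ + f q = (2 * (j : ℝ) - 1) * L ∨
        θ + f q = (2 * (j : ℝ) + 1) * L)) :
    ∑' j, volume (E j) ≤ ENNReal.ofReal (unitBallVol n * ρ ^ n * (2 * s) *
      (2 * ((‖fderiv ℝ f x‖ + ω) / (‖fderiv ℝ f x‖ - ω)) + (n + 1))) := by
  set G := ‖fderiv ℝ f x‖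
  have hω0 : 0 ≤ ω := (norm_nonneg _).trans (hω x (Metric.mem_ball_self (by linarith)))
  set m : ℤ := ⌊(θ + f x) / (2 * L)⌋ with hm
  have hm1 : 2 * (m : ℝ) * L ≤ θ + f x := by
    have := Int.floor_le ((θ + f x) / (2 * L))
    rw [← hm, le_div_iff₀ (by linarith)] at this
    linarith
  have hm2 : θ + f x < 2 * ((m : ℝ) + 1) * L := by
    have := Int.lt_floor_add_one ((θ + f x) / (2 * L))
    rw [← hm, div_lt_iff₀ (by linarith)] at this
    linarith
  -- the level nearest to the value at the centre
  set c : ℝ := (2 * (m : ℝ) + 1) * L with hc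
  have hin : ∀ {p q}, p ∈ Metric.ball x ρ → dist q p < s → q ∈ Metric.ball x (ρ + s) := by
    intro p q hp hq
    have := dist_triangle q p x
    have := Metric.mem_ball.1 hp
    rw [Metric.mem_ball]
    linarith
  have hfx : ∀ {q}, q ∈ Metric.ball x (ρ + s) →
      (2 * (m : ℝ) - 1 / 2) * L ≤ θ + f q ∧ θ + f q < (2 * (m : ℝ) + 5 / 2) * L := by
    intro q hq
    have := abs_le.1 (hosc q hq)
    constructor <;> linarith
  set W := {p ∈ Metric.ball x ρ | |f p - (c - θ)| < s * (G + ω)} with hW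
  have hWmem : ∀ {p q}, p ∈ Metric.ball x ρ → dist q p < s → θ + f q = c → p ∈ W := by
    intro p q hp hq hqc
    refine ⟨hp, ?_⟩
    have h1 := abs_sub_le_of_fderiv_close hd hω (hin hp (q := p) (by simpa using hs)) (hin hp hq)
    rw [show c - θ = f q by linarith]
    rw [dist_comm] at hq
    have hG : 0 < G + ω := by linarith
    calc |f p - f q| ≤ (G + ω) * dist p q := h1
      _ < (G + ω) * s := by gcongr
      _ = s * (G + ω) := mul_comm _ _
  have hjm : ∀ j : ℤ, ∀ p ∈ E j, j = m ∨ j = m + 1 := by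
    intro j p hp
    obtain ⟨q, hq, hq1, hq2, -⟩ := hE j p hp
    obtain ⟨h1, h2⟩ := hfx (hin (hball j hp) hq)
    have h3 : 2 * (m : ℝ) - 1 / 2 ≤ 2 * j + 1 := le_of_mul_le_mul_right (h1.trans hq2) hL
    have h4 : 2 * (j : ℝ) - 1 < 2 * m + 5 / 2 := lt_of_mul_lt_mul_right (hq1.trans_lt h2) hL.le
    have h5 : (m : ℝ) < j + 1 := by linarith
    have h6 : (j : ℝ) < m + 2 := by linarith
    have h5' : m < j + 1 := by exact_mod_cast h5
    have h6' : j < m + 2 := by exact_mod_cast h6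
    omega
  set F := ⋃ i : Fin (n + 1), {p ∈ Metric.ball x ρ | |(|p i| - a i)| < s} with hF
  have hWF : ∀ j, E j ⊆ W ∪ F := by
    intro j p hp
    have hpb := hball j hp
    obtain ⟨q, hq, -, -, hq3⟩ := hE j p hp
    have hqb := hin hpb hq
    obtain ⟨h1, h2⟩ := hfx hqb
    rcases hq3 with ⟨i, hi⟩ | hlev
    · refine Or.inr (mem_iUnion.2 ⟨i, hpb, ?_⟩)
      rw [← hi]
      refine (abs_abs_sub_abs_le _ _).trans_lt (lt_of_le_of_lt ?_ hq)
      rw [dist_comm, dist_eq_norm]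
      simpa using PiLp.norm_apply_le (p - q) i
    · refine Or.inl (hWmem hpb hq ?_)
      rcases hjm j p hp with rfl | rfl <;> rcases hlev with h | h
      · nlinarith
      · exact h
      · rw [h, hc]; push_cast; ring
      · rw [h] at h2
        push_cast at h2
        nlinarith
  have hinter : E m ∩ E (m + 1) ⊆ W := by
    rintro p ⟨hp, hp'⟩
    have hpb := hball m hp
    obtain ⟨q, hq, -, hq2, -⟩ := hE m p hp
    obtain ⟨q', hq', hq1', -, -⟩ := hE (m + 1) p hp'
    have hcont : ContinuousOn (fun y => θ + f y) (Metric.ball p s) := fun y hy =>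
      (continuousAt_const.add (hd y (hin hpb hy)).continuousAt).continuousWithinAt
    have hcm : c ∈ Icc (θ + f q) (θ + f q') := by
      refine ⟨hq2, ?_⟩
      push_cast at hq1'
      rw [hc]
      linarith
    obtain ⟨y, hy, hyc⟩ := (convex_ball p s).isPreconnected.intermediate_value hq hq' hcont hcm
    exact hWmem hpb hy hyc
  have hsub : Metric.ball x ρ ⊆ Metric.ball x (ρ + s) := Metric.ball_subset_ball (by linarith)
  have hvW : volume W ≤
      ENNReal.ofReal (unitBallVol n * ρ ^ n * (2 * (s * (G + ω)) / (G - ω))) :=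
    volume_levelSlab_le (fun p hp => hd p (hsub hp)) (fun p hp => hω p (hsub hp)) hρ hlt
    (c - θ) (s * (G + ω))
  have hvF : volume F ≤ ENNReal.ofReal ((n + 1) * (unitBallVol n * ρ ^ n * (2 * s))) := by
    refine (measure_iUnion_le _).trans ?_
    rw [tsum_fintype]
    refine (Finset.sum_le_sum fun i _ => volume_faceSlab_le i hρ (ha i)).trans (le_of_eq ?_)
    rw [Finset.sum_const, Finset.card_univ, Fintype.card_fin, nsmul_eq_mul,
      ← Nat.cast_succ, ENNReal.ofReal_mul (Nat.cast_nonneg _), ENNReal.ofReal_natCast]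
  have hγn := unitBallVol_pos n
  have hGω : 0 < G - ω := by linarith
  have hG0 : 0 < G + ω := by linarith
  refine (tsum_volume_le_of_two hmeas (fun j ⟨p, hp⟩ => hjm j p hp) hWF hinter).trans ?_
  refine (add_le_add (mul_le_mul_right hvW 2) hvF).trans (le_of_eq ?_)
  have h2 : ∀ b : ℝ, 2 * ENNReal.ofReal b = ENNReal.ofReal (2 * b) := fun b => by
    rw [ENNReal.ofReal_mul zero_le_two, ENNReal.ofReal_ofNat]
  rw [h2, ← ENNReal.ofReal_add (by positivity) (by positivity)]
  congr 1
  field_simp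

end Slabs

/-! ### The pieces -/

section Pieces

variable {k : ℕ} {Φ₀ : Euc k → ℝ} {L β γ : ℝ}

theorem isOpen_piece (hγ : 0 < γ) (hβ : 0 < β) (hΦ₀ : ContDiffOn ℝ 2 Φ₀ (openCube k (L + β)))
    (θ : ℝ) (j : ℤ) : IsOpen (piece Φ₀ L γ θ j) := by
  have h1 : ContinuousOn (fun u => θ + pulled Φ₀ γ u) (openBox k L γ 0) :=
    continuousOn_const.add ((contDiffOn_pulled hΦ₀).continuousOn.mono
      ((openBox_subset_closedBox hγ).trans (closedBox_subset_openBox hγ hβ)))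
  exact h1.isOpen_inter_preimage (isOpen_openBox k L γ 0) isOpen_Ioo

theorem piece_subset_closedBox (hγ : 0 < γ) (θ : ℝ) (j : ℤ) :
    piece Φ₀ L γ θ j ⊆ closedBox k L γ 0 := fun _ hx => openBox_subset_closedBox hγ hx.1

theorem disjoint_piece (hL : 0 < L) (θ : ℝ) {i j : ℤ} (hij : i ≠ j) :
    Disjoint (piece Φ₀ L γ θ i) (piece Φ₀ L γ θ j) := by
  rw [disjoint_left]
  rintro x ⟨-, h1, h2⟩ ⟨-, h3, h4⟩
  have h5 : 2 * (i : ℝ) - 1 < 2 * j + 1 := lt_of_mul_lt_mul_right (h1.trans h4) hL.le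
  have h6 : 2 * (j : ℝ) - 1 < 2 * i + 1 := lt_of_mul_lt_mul_right (h3.trans h2) hL.le
  have h5' : (i : ℝ) < j + 1 := by linarith
  have h6' : (j : ℝ) < i + 1 := by linarith
  norm_cast at h5' h6'
  omega

theorem finite_nonempty_piece (hL : 0 < L) (hγ : 0 < γ) (hβ : 0 < β)
    (hΦ₀ : ContDiffOn ℝ 2 Φ₀ (openCube k (L + β))) (θ : ℝ) :
    {j : ℤ | (piece Φ₀ L γ θ j).Nonempty}.Finite := by
  obtain ⟨B, hB⟩ := (isCompact_closedBox k L γ 0).exists_bound_of_continuousOn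
    ((contDiffOn_pulled hΦ₀).continuousOn.mono (closedBox_subset_openBox hγ hβ))
  set N : ℤ := ⌈(|θ| + B) / L⌉ + 1 with hN
  refine (finite_Icc (-N) N).subset ?_
  rintro j ⟨x, hx⟩
  have hxB := abs_le.1 (hB x (piece_subset_closedBox hγ θ j hx))
  obtain ⟨-, h1, h2⟩ := hx
  have hθ := abs_le.1 (le_refl |θ|)
  have hNle : |θ| + B ≤ ((N : ℝ) - 1) * L := by
    rw [← div_le_iff₀ hL, hN]
    push_cast
    linarith [Int.le_ceil ((|θ| + B) / L)]
  simp only [pulled] at hxB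
  have h3 : (2 * (j : ℝ) - 1) * L < ((N : ℝ) - 1) * L := by linarith
  have h4 : (-((N : ℝ) - 1)) * L < (2 * (j : ℝ) + 1) * L := by linarith
  have h5 := lt_of_mul_lt_mul_right h3 hL.le
  have h6 := lt_of_mul_lt_mul_right h4 hL.le
  have h5' : 2 * (j : ℝ) < N := by linarith
  have h6' : -(N : ℝ) < 2 * j + 0 := by linarith
  norm_cast at h5' h6'
  rw [mem_Icc]
  omega

theorem closure_piece_subset (hγ : 0 < γ) (hβ : 0 < β)
    (hΦ₀ : ContDiffOn ℝ 2 Φ₀ (openCube k (L + β))) (θ : ℝ) (j : ℤ) :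
    closure (piece Φ₀ L γ θ j) ⊆ closedBox k L γ 0 ∩
      (fun u => θ + pulled Φ₀ γ u) ⁻¹' Icc ((2 * (j : ℝ) - 1) * L) ((2 * (j : ℝ) + 1) * L) := by
  have h1 : ContinuousOn (fun u => θ + pulled Φ₀ γ u) (closedBox k L γ 0) :=
    continuousOn_const.add ((contDiffOn_pulled hΦ₀).continuousOn.mono
      (closedBox_subset_openBox hγ hβ))
  exact closure_minimal (fun x hx => ⟨piece_subset_closedBox hγ θ j hx, hx.2.1.le, hx.2.2.le⟩)
    (h1.preimage_isClosed_of_isClosed (isClosed_closedBox k L γ 0) isClosed_Icc)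

theorem isCompact_closure_piece (hγ : 0 < γ) (θ : ℝ) (j : ℤ) :
    IsCompact (closure (piece Φ₀ L γ θ j)) :=
  (isCompact_closedBox k L γ 0).closure_of_subset (piece_subset_closedBox hγ θ j)

/-- A boundary point of a piece lies on a face of the box or on a level set bounding the piece. -/
theorem boundary_piece_cases (hγ : 0 < γ) (hβ : 0 < β)
    (hΦ₀ : ContDiffOn ℝ 2 Φ₀ (openCube k (L + β))) (θ : ℝ) (j : ℤ) {q : Euc k}
    (hq : q ∈ closure (piece Φ₀ L γ θ j) \ piece Φ₀ L γ θ j) :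
    (∃ i : Fin k, |q i| = γ ^ (i : ℕ) * L) ∨ θ + pulled Φ₀ γ q = (2 * (j : ℝ) - 1) * L ∨
      θ + pulled Φ₀ γ q = (2 * (j : ℝ) + 1) * L := by
  obtain ⟨hqb, hq1, hq2⟩ := closure_piece_subset hγ hβ hΦ₀ θ j hq.1
  by_contra! hcon
  obtain ⟨h1, h2, h3⟩ := hcon
  refine hq.2 ⟨(mem_openBox_iff hγ).2 fun i => ?_, lt_of_le_of_ne hq1 (Ne.symm h2),
    lt_of_le_of_ne hq2 h3⟩
  have h4 := hqb i
  rw [add_zero] at h4 ⊢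
  exact lt_of_le_of_ne h4 (h1 i)

theorem enlargedPiece_subset_closedBox (hγ : 0 < γ) (hγ1 : γ ≤ 1) {εm t : ℝ} (ht : 0 ≤ t)
    (hεm : εm ≤ γ ^ (k - 1) * t) (θ : ℝ) (j : ℤ) :
    enlargedPiece Φ₀ L γ θ εm j ⊆ closedBox k L γ t := by
  intro y hy
  obtain ⟨x, hx, hxy⟩ := Metric.mem_thickening_iff.1 hy
  exact mem_closedBox_of_dist_le hγ hγ1 ht (by simp) (piece_subset_closedBox hγ θ j hx)
    (hxy.le.trans hεm)

theorem transf_eqOn_branch (hL : 0 < L) (θ : ℝ) (j : ℤ) :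
    EqOn (transf Φ₀ L γ θ) (branch Φ₀ L γ θ j) (piece Φ₀ L γ θ j) := by
  rintro x ⟨-, h1, h2⟩
  have hfl : ⌊(Φ₀ (dilation γ x) + θ + L) / (2 * L)⌋ = j := by
    rw [Int.floor_eq_iff, le_div_iff₀ (by linarith), div_lt_iff₀ (by linarith)]
    constructor <;> linarith
  have hfold : foldedMap Φ₀ L θ (dilation γ x) = Φ₀ (dilation γ x) + (θ - 2 * (j : ℝ) * L) := by
    rw [foldedMap, hfl]; ring
  ext i
  simp only [transf, branch, shiftMap, hfold]

end Pieces

/-! ### Covering, distortion and null sets -/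

section Properties

variable {k : ℕ} {Φ₀ : Euc k → ℝ} {L β γ c : ℝ}

theorem thickening_transf_subset (hL : 0 < L) (hc : 0 < c)
    (hΦ₀ : ContDiffOn ℝ 2 Φ₀ (openCube k (L + β))) (θ : ℝ) (j : ℤ)
    (hexp : ∀ u ∈ openBox k L γ β, ∀ v ∈ openBox k L γ β,
      c * dist u v ≤ dist (branch Φ₀ L γ θ j u) (branch Φ₀ L γ θ j v)) {εm : ℝ} (hεm : 0 < εm)
    (hV : enlargedPiece Φ₀ L γ θ εm j ⊆ openBox k L γ β) :
    Metric.thickening (c * (εm / 2) / 2) (transf Φ₀ L γ θ '' piece Φ₀ L γ θ j) ⊆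
      branch Φ₀ L γ θ j '' enlargedPiece Φ₀ L γ θ εm j := by
  intro y hy
  obtain ⟨z, ⟨u, hu, rfl⟩, hyz⟩ := Metric.mem_thickening_iff.1 hy
  rw [transf_eqOn_branch hL θ j hu] at hyz
  have hB : Metric.closedBall u (εm / 2) ⊆ enlargedPiece Φ₀ L γ θ εm j := fun p hp =>
    Metric.mem_thickening_iff.2 ⟨u, hu, (Metric.mem_closedBall.1 hp).trans_lt (by linarith)⟩
  exact image_mono hB (ball_subset_image_closedBall_of_expanding (isOpen_openBox k L γ β) hc hexp
    (contDiffOn_branch hΦ₀ θ j) (by positivity) (hB.trans hV) hyz)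

theorem contDiff_clm_det {E : Type*} [NormedAddCommGroup E] [NormedSpace ℝ E]
    [FiniteDimensional ℝ E] {m : WithTop ℕ∞} : ContDiff ℝ m fun A : E →L[ℝ] E => A.det := by
  classical
  let b := Module.finBasis ℝ E
  have h : (fun A : E →L[ℝ] E => A.det) = fun A => ∑ τ : Equiv.Perm (Fin (Module.finrank ℝ E)),
      Equiv.Perm.sign τ • ∏ i, b.repr (A (b i)) (τ i) := by
    funext A
    rw [ContinuousLinearMap.det, ← LinearMap.det_toMatrix b, Matrix.det_apply]
    simp [LinearMap.toMatrix_apply]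
  rw [h]
  refine ContDiff.sum fun τ _ => ContDiff.const_smul _ (contDiff_prod fun i _ => ?_)
  let ℓ : (E →L[ℝ] E) →ₗ[ℝ] ℝ :=
    { toFun := fun A => b.repr (A (b i)) (τ i)
      map_add' := fun A B => by simp
      map_smul' := fun a A => by simp }
  exact (LinearMap.toContinuousLinearMap ℓ).contDiff

/-- The distortion constant is uniform since all branches, for all parameters, have the same
derivative, a `C¹` function on a neighbourhood of a compact convex box. -/
theorem exists_distortion_bound (hc : 0 < c) (hγ : 0 < γ) {t : ℝ} (ht : t < β)
    (hΦ₀ : ContDiffOn ℝ 2 Φ₀ (openCube k (L + β)))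
    (hexp : ∀ (θ : ℝ) (j : ℤ), ∀ u ∈ openBox k L γ β, ∀ v ∈ openBox k L γ β,
      c * dist u v ≤ dist (branch Φ₀ L γ θ j u) (branch Φ₀ L γ θ j v)) :
    ∃ K : ℝ, 0 < K ∧ ∀ (θ : ℝ) (j : ℤ) (V : Set (Euc k)), IsOpen V → V ⊆ closedBox k L γ t →
      ∀ ε : ℝ, 0 < ε → ∀ z ∈ branch Φ₀ L γ θ j '' V,
        ∀ x ∈ Metric.ball z ε ∩ branch Φ₀ L γ θ j '' V,
        ∀ y ∈ Metric.ball z ε ∩ branch Φ₀ L γ θ j '' V,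
          |(fderiv ℝ (Function.invFunOn (branch Φ₀ L γ θ j) V) x).det -
              (fderiv ℝ (Function.invFunOn (branch Φ₀ L γ θ j) V) y).det| ≤
            K * |(fderiv ℝ (Function.invFunOn (branch Φ₀ L γ θ j) V) z).det| * ε := by
  have hopen := isOpen_openBox k L γ β
  have hsub : closedBox k L γ t ⊆ openBox k L γ β := closedBox_subset_openBox hγ ht
  set d : Euc k → ℝ := fun p => (fderiv ℝ (branch Φ₀ L γ 0 0) p).det with hd
  have hdC : ContDiffOn ℝ 1 d (openBox k L γ β) :=
    contDiff_clm_det.comp_contDiffOn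
      ((contDiffOn_branch hΦ₀ 0 0).fderiv_of_isOpen hopen (by norm_num))
  have hd0 : ∀ p ∈ openBox k L γ β, d p ≠ 0 := fun p hp =>
    det_fderiv_ne_zero_of_expanding hopen hc (hexp 0 0) (contDiffOn_branch hΦ₀ 0 0) hp
  obtain ⟨Λ, hΛ⟩ := ((hdC.inv hd0).mono hsub).exists_lipschitzOnWith (by norm_num)
    (convex_closedBox k L γ t) (isCompact_closedBox k L γ t)
  obtain ⟨B, hB⟩ := (isCompact_closedBox k L γ t).exists_bound_of_continuousOn
    (hdC.continuousOn.mono hsub)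
  refine ⟨Λ * (2 / c) * (|B| + 1) + 1, by positivity, ?_⟩
  rintro θ j V hV hVt ε hε _ ⟨r, hr, rfl⟩ _ ⟨hx, p, hp, rfl⟩ _ ⟨hy, q, hq, rfl⟩
  have hVo := hVt.trans hsub
  have hexpV : ∀ u ∈ V, ∀ v ∈ V, c * dist u v ≤ dist (branch Φ₀ L γ θ j u) (branch Φ₀ L γ θ j v) :=
    fun u hu v hv => hexp θ j u (hVo hu) v (hVo hv)
  have hdet : ∀ u ∈ V, (fderiv ℝ (Function.invFunOn (branch Φ₀ L γ θ j) V)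
      (branch Φ₀ L γ θ j u)).det = (d u)⁻¹ := fun u hu => by
    rw [det_fderiv_invFunOn_of_expanding hV hc hexpV ((contDiffOn_branch hΦ₀ θ j).mono hVo) hu,
      fderiv_branch_eq]
  rw [hdet p hp, hdet q hq, hdet r hr]
  have h1 : |(d p)⁻¹ - (d q)⁻¹| ≤ Λ * dist p q := hΛ.dist_le_mul p (hVt hp) q (hVt hq)
  have h2 : dist p q ≤ 2 / c * ε := by
    rw [div_mul_eq_mul_div, le_div_iff₀ hc, mul_comm]
    have h3 := hexpV p hp q hq
    have h4 := dist_triangle_right (branch Φ₀ L γ θ j p) (branch Φ₀ L γ θ j q)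
      (branch Φ₀ L γ θ j r)
    have h5 := Metric.mem_ball.1 hx
    have h6 := Metric.mem_ball.1 hy
    linarith
  have h3 : 1 ≤ (|B| + 1) * |(d r)⁻¹| := by
    rw [abs_inv, ← div_eq_mul_inv, le_div_iff₀ (abs_pos.2 (hd0 r (hVo hr)))]
    have := hB r (hVt hr)
    rw [Real.norm_eq_abs] at this
    linarith [le_abs_self B]
  calc |(d p)⁻¹ - (d q)⁻¹| ≤ Λ * (2 / c * ε) * 1 := by
        rw [mul_one]
        exact h1.trans (by gcongr)
    _ ≤ Λ * (2 / c * ε) * ((|B| + 1) * |(d r)⁻¹|) := by gcongr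
    _ ≤ Λ * (2 / c * ε) * ((|B| + 1) * |(d r)⁻¹|) + |(d r)⁻¹| * ε := by
        have : 0 ≤ |(d r)⁻¹| * ε := by positivity
        linarith
    _ = (Λ * (2 / c) * (|B| + 1) + 1) * |(d r)⁻¹| * ε := by ring

theorem volume_coord_eq_zero (i : Fin k) (a : ℝ) : volume {x : Euc k | x i = a} = 0 := by
  have h := Measure.pi_hyperplane (fun _ : Fin k => (volume : Measure ℝ)) i a
  rw [← volume_pi] at h
  exact (PiLp.volume_preserving_ofLp (Fin k)).quasiMeasurePreserving.preimage_null h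

/-- A branch maps the level set into a hyperplane, and its inverse is differentiable. -/
theorem volume_level_eq_zero (hk : 0 < k) (hc : 0 < c)
    (hΦ₀ : ContDiffOn ℝ 2 Φ₀ (openCube k (L + β)))
    (hexp : ∀ u ∈ openBox k L γ β, ∀ v ∈ openBox k L γ β,
      c * dist u v ≤ dist (branch Φ₀ L γ 0 0 u) (branch Φ₀ L γ 0 0 v)) (a : ℝ) :
    volume {x ∈ openBox k L γ β | pulled Φ₀ γ x = a} = 0 := by
  set T := branch Φ₀ L γ 0 0
  set V := openBox k L γ β
  have hopen : IsOpen V := isOpen_openBox k L γ β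
  have hinj : InjOn T V := injOn_of_expanding hc hexp
  have hC : ContDiffOn ℝ 2 (Function.invFunOn T V) (T '' V) :=
    contDiffOn_invFunOn_of_expanding hopen hc hexp (contDiffOn_branch hΦ₀ 0 0)
  let l : Fin k := ⟨k - 1, by omega⟩
  have hnull : volume (T '' V ∩ {y | y l = γ ^ (k - 1) * a}) = 0 :=
    measure_mono_null inter_subset_right (volume_coord_eq_zero l _)
  refine measure_mono_null ?_ (addHaar_image_eq_zero_of_differentiableOn_of_addHaar_eq_zero volume
    ((hC.differentiableOn (by norm_num)).mono inter_subset_left) hnull)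
  rintro x ⟨hx, hxa⟩
  refine ⟨T x, ⟨mem_image_of_mem _ hx, ?_⟩, hinj.leftInvOn_invFunOn hx⟩
  have h : ¬ (l : ℕ) + 1 < k := by simp only [l]; omega
  simp only [T, branch, shiftMap, mem_ofPred_eq, h, dif_neg, not_false_eq_true]
  rw [← hxa, pulled]
  simp

theorem volume_box_diff_iUnion_piece (hk : 0 < k) (hc : 0 < c) (hL : 0 < L) (hγ : 0 < γ)
    (hβ : 0 < β) (hΦ₀ : ContDiffOn ℝ 2 Φ₀ (openCube k (L + β)))
    (hexp : ∀ u ∈ openBox k L γ β, ∀ v ∈ openBox k L γ β,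
      c * dist u v ≤ dist (branch Φ₀ L γ 0 0 u) (branch Φ₀ L γ 0 0 v)) (θ : ℝ) :
    volume (box k L γ \ ⋃ j : ℤ, piece Φ₀ L γ θ j) = 0 := by
  have hfaces : volume (⋃ i : Fin k, ({x : Euc k | x i = γ ^ (i : ℕ) * L} ∪
      {x : Euc k | x i = -(γ ^ (i : ℕ) * L)})) = 0 :=
    measure_iUnion_null fun i => measure_union_null (volume_coord_eq_zero i _)
      (volume_coord_eq_zero i _)
  have hlev : volume (⋃ j : ℤ, {x ∈ openBox k L γ β |
      pulled Φ₀ γ x = (2 * (j : ℝ) - 1) * L - θ}) = 0 :=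
    measure_iUnion_null fun j => volume_level_eq_zero hk hc hΦ₀ hexp _
  refine measure_mono_null ?_ (measure_union_null hfaces hlev)
  rintro x ⟨hx, hxU⟩
  rw [box_eq_closedBox] at hx
  by_cases hface : ∃ i : Fin k, |x i| = γ ^ (i : ℕ) * L
  · obtain ⟨i, hi⟩ := hface
    refine Or.inl (mem_iUnion.2 ⟨i, ?_⟩)
    rcases abs_choice (x i) with h | h
    · left; rw [h] at hi; exact hi
    · right; rw [h] at hi; rw [mem_ofPred_eq, ← hi, neg_neg]
  · push Not at hface
    have hx0 : x ∈ openBox k L γ 0 := (mem_openBox_iff hγ).2 fun i => by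
      have h4 := hx i
      rw [add_zero] at h4 ⊢
      exact lt_of_le_of_ne h4 (hface i)
    refine Or.inr (mem_iUnion.2 ⟨⌊(θ + pulled Φ₀ γ x + L) / (2 * L)⌋,
      closedBox_subset_openBox hγ hβ hx, ?_⟩)
    have h1 := Int.floor_le ((θ + pulled Φ₀ γ x + L) / (2 * L))
    have h2 := Int.lt_floor_add_one ((θ + pulled Φ₀ γ x + L) / (2 * L))
    set j := ⌊(θ + pulled Φ₀ γ x + L) / (2 * L)⌋
    rw [le_div_iff₀ (by linarith)] at h1
    rw [div_lt_iff₀ (by linarith)] at h2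
    by_contra hne
    refine hxU (mem_iUnion.2 ⟨j, hx0, lt_of_le_of_ne ?_ fun h => hne ?_, ?_⟩)
    · change _ ≤ θ + pulled Φ₀ γ x
      linarith
    · change _ = θ + pulled Φ₀ γ x at h
      linarith
    · change θ + pulled Φ₀ γ x < _
      linarith

end Properties

/-! ### The geometric constant of the family -/

theorem one_lt_and_eta0_lt_one_of_threshold_lt {k Y : ℕ} (hY : 0 < Y) {σ : ℝ} (hσ : threshold k Y < σ) :
    1 < σ ∧ eta0 k Y σ < 1 := by
  obtain ⟨h1, h2, -⟩ := threshold_spec k Y hY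
  set s := threshold k Y
  have hs : 1 < √s := Real.lt_sqrt_of_sq_lt (by simpa using h1)
  have hlt : √s < √σ := Real.sqrt_lt_sqrt (by linarith) hσ
  refine ⟨h1.trans hσ, ?_⟩
  rw [← h2, eta0, eta0]
  have hA : 0 < unitBallVol (k - 1) / unitBallVol k := div_pos (unitBallVol_pos _) (unitBallVol_pos _)
  have hY' : (0 : ℝ) < Y := by exact_mod_cast hY
  have h3 : 1 / √σ < 1 / √s := one_div_lt_one_div_of_lt (by linarith) hlt
  have h4 : 4 / (√σ - 1) < 4 / (√s - 1) :=
    div_lt_div_of_pos_left (by norm_num) (by linarith) (by linarith)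
  gcongr

/-- Since a branch expands distances by `c`, points sent `ε`-close to the boundary of the image of a
piece are `ε / c`-close to the boundary of the piece. -/
theorem exists_boundary_point_near {k : ℕ} {Φ₀ : Euc k → ℝ} {L β γ c ε εm : ℝ} (hc : 0 < c) (hγ : 0 < γ)
    (hβ : 0 < β) (hΦ₀ : ContDiffOn ℝ 2 Φ₀ (openCube k (L + β))) (θ : ℝ) (j : ℤ)
    (hexp : ∀ u ∈ openBox k L γ β, ∀ v ∈ openBox k L γ β,
      c * dist u v ≤ dist (branch Φ₀ L γ θ j u) (branch Φ₀ L γ θ j v))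
    (hV : enlargedPiece Φ₀ L γ θ εm j ⊆ openBox k L γ β) {p : Euc k}
    (hp : p ∈ enlargedPiece Φ₀ L γ θ εm j ∩ branch Φ₀ L γ θ j ⁻¹'
      Metric.thickening ε (frontier (branch Φ₀ L γ θ j '' piece Φ₀ L γ θ j))) :
    ∃ q ∈ closure (piece Φ₀ L γ θ j) \ piece Φ₀ L γ θ j, dist q p < ε / c := by
  have hcl : closure (piece Φ₀ L γ θ j) ⊆ openBox k L γ β := fun q hq =>
    closedBox_subset_openBox hγ hβ (closure_piece_subset hγ hβ hΦ₀ θ j hq).1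
  obtain ⟨hpV, hpT⟩ := hp
  rw [mem_preimage, Metric.mem_thickening_iff] at hpT
  obtain ⟨w, hw, hpw⟩ := hpT
  obtain ⟨q, hq, rfl⟩ := frontier_image_subset_of_expanding (isOpen_openBox k L γ β) hc hexp
    (contDiffOn_branch hΦ₀ θ j) (isOpen_piece hγ hβ hΦ₀ θ j) (isCompact_closure_piece hγ θ j)
    hcl hw
  refine ⟨q, hq, ?_⟩
  rw [lt_div_iff₀ hc, dist_comm, mul_comm]
  exact (hexp p (hV hpV) q (hcl hq.1)).trans_lt hpw

theorem geomConst_le {k : ℕ} {Φ₀ : Euc k → ℝ} {L γ θ εm σ δ c : ℝ} (hc : 0 ≤ c)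
    (h : ∀ ε, 0 < ε → ε ≤ δ → ∀ x, boundaryRatio Φ₀ L γ θ εm σ x ε δ ≤
      ENNReal.ofReal (c * (ε / δ))) :
    geomConst Φ₀ L γ θ εm σ δ ≤ ENNReal.ofReal (1 / √σ + 2 * c) := by
  rw [ENNReal.ofReal_add (by positivity) (by positivity), ENNReal.ofReal_mul zero_le_two,
    ENNReal.ofReal_ofNat, geomConst]
  gcongr
  refine iSup₂_le fun ε hε => ?_
  have hε0 : 0 < ε := hε.1
  have hδ0 : 0 < δ := hε0.trans_le hε.2
  calc (⨆ x, boundaryRatio Φ₀ L γ θ εm σ x ε δ) / ENNReal.ofReal ε * ENNReal.ofReal δ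
      ≤ ENNReal.ofReal (c * (ε / δ)) / ENNReal.ofReal ε * ENNReal.ofReal δ := by
        gcongr
        exact iSup_le (h ε hε0 hε.2)
    _ = ENNReal.ofReal c := by
        rw [← ENNReal.ofReal_div_of_pos hε0, ← ENNReal.ofReal_mul (by positivity)]
        congr 1
        field_simp

section Ratio

variable {n : ℕ} {Φ₀ : Euc (n + 1) → ℝ} {L β γ σ : ℝ}

/-- The bound for one ball. With `s = ε / √σ` and `ρ = (1 - 1/√σ) δ` one has `ρ + s ≤ δ`, so
everything relevant happens in `B(x, δ)`, where the derivative of `Φ₀ ∘ Γ` varies by at most `Λ δ`.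
The factor `R > 1` absorbs the curvature of the level sets. -/
theorem boundaryRatio_le (hσ : 1 < σ) (hL : 0 < L) (hγ : 0 < γ) (hγ1 : γ ≤ 1) (hβ : 0 < β)
    (hΦ₀ : ContDiffOn ℝ 2 Φ₀ (openCube (n + 1) (L + β))) {θ : ℝ}
    (hexp : ∀ j : ℤ, ∀ u ∈ openBox (n + 1) L γ β, ∀ v ∈ openBox (n + 1) L γ β,
      √σ * dist u v ≤ dist (branch Φ₀ L γ θ j u) (branch Φ₀ L γ θ j v))
    {g Λ Λ₀ R ε₀ εm ε δ : ℝ} (hg : 0 < g)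
    (hgrad : ∀ u ∈ openBox (n + 1) L γ β, g ≤ ‖fderiv ℝ (pulled Φ₀ γ) u‖)
    (hΛ0 : 0 ≤ Λ) (hΛ₀0 : 0 ≤ Λ₀)
    (hΛ : ∀ p ∈ closedBox (n + 1) L γ (β / 2), ∀ q ∈ closedBox (n + 1) L γ (β / 2),
      ‖fderiv ℝ (pulled Φ₀ γ) p - fderiv ℝ (pulled Φ₀ γ) q‖ ≤ Λ * dist p q)
    (hΛ₀ : ∀ p ∈ closedBox (n + 1) L γ (β / 2), ∀ q ∈ closedBox (n + 1) L γ (β / 2),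
      |pulled Φ₀ γ p - pulled Φ₀ γ q| ≤ Λ₀ * dist p q)
    (hR : 1 < R) (hε₁ : Λ * ε₀ ≤ g * (R - 1) / (R + 1)) (hε₂ : Λ₀ * ε₀ ≤ L / 2)
    (hε₃ : ε₀ ≤ γ ^ n * L) (hε₄ : ε₀ ≤ γ ^ n * (β / 8)) (hεm : εm ≤ γ ^ n * (β / 4))
    (hε : 0 < ε) (hεδ : ε ≤ δ) (hδ : δ ≤ ε₀) (x : Euc (n + 1)) :
    boundaryRatio Φ₀ L γ θ εm σ x ε δ ≤ ENNReal.ofReal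
      (2 / (√σ - 1) * (unitBallVol n / unitBallVol (n + 1)) * (2 * R + (n + 1)) * (ε / δ)) := by
  have hδ0 : 0 < δ := hε.trans_le hεδ
  have hσ1 : 1 < √σ := Real.lt_sqrt_of_sq_lt (by simpa using hσ)
  have hσ0 : 0 < √σ := by linarith
  have hinv : 1 / √σ < 1 := by rwa [div_lt_one hσ0]
  set ρ : ℝ := (1 - 1 / √σ) * δ with hρdef
  set s : ℝ := ε / √σ with hsdef
  have hρ : 0 < ρ := mul_pos (by linarith) hδ0
  have hs : 0 < s := by positivity
  have hρs : ρ + s ≤ δ := by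
    have : s ≤ 1 / √σ * δ := by
      rw [hsdef, div_eq_mul_one_div, mul_comm]
      gcongr
    rw [hρdef]
    linarith
  have hγn := unitBallVol_pos n
  have hγn1 := unitBallVol_pos (n + 1)
  set E : ℤ → Set (Euc (n + 1)) := fun j => (enlargedPiece Φ₀ L γ θ εm j ∩
        branch Φ₀ L γ θ j ⁻¹'
          Metric.thickening ε (frontier (branch Φ₀ L γ θ j '' piece Φ₀ L γ θ j))) ∩
        Metric.ball x ρ with hE
  have hVc : ∀ j, enlargedPiece Φ₀ L γ θ εm j ⊆ closedBox (n + 1) L γ (β / 4) := fun j =>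
    enlargedPiece_subset_closedBox hγ hγ1 (by positivity) hεm θ j
  have hVo : ∀ j, enlargedPiece Φ₀ L γ θ εm j ⊆ openBox (n + 1) L γ β := fun j =>
    (hVc j).trans (closedBox_subset_openBox hγ (by linarith))
  have hratio : boundaryRatio Φ₀ L γ θ εm σ x ε δ
      = (∑' j, volume (E j)) / ENNReal.ofReal (unitBallVol (n + 1) * ρ ^ (n + 1)) := by
    rw [← volume_ball_eq_unitBallVol (n + 1) x hρ, div_eq_mul_inv, ← ENNReal.tsum_mul_right]
    rfl
  rw [hratio]
  by_cases hne : ∃ j, (E j).Nonempty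
  swap
  · push Not at hne
    simp [hne]
  obtain ⟨j₀, p₀, hp₀⟩ := hne
  have hball : ∀ p ∈ Metric.ball x (ρ + s), p ∈ closedBox (n + 1) L γ (β / 2) := by
    intro p hp
    refine mem_closedBox_of_dist_le hγ hγ1 (t := β / 4) (by positivity) (by linarith)
      (hVc j₀ hp₀.1.1) ?_
    have h1 := dist_triangle_right p p₀ x
    have h2 := Metric.mem_ball.1 hp
    have h3 := Metric.mem_ball.1 hp₀.2
    rw [Nat.add_sub_cancel]
    linarith
  have hball' : ∀ p ∈ Metric.ball x (ρ + s), p ∈ openBox (n + 1) L γ β := fun p hp =>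
    closedBox_subset_openBox hγ (by linarith) (hball p hp)
  have hxb : x ∈ Metric.ball x (ρ + s) := Metric.mem_ball_self (by linarith)
  have hdistx : ∀ p ∈ Metric.ball x (ρ + s), dist p x ≤ ε₀ := fun p hp => by
    have := Metric.mem_ball.1 hp
    linarith
  set G := ‖fderiv ℝ (pulled Φ₀ γ) x‖
  have hgG : g ≤ G := hgrad x (hball' x hxb)
  have hωR : Λ * ε₀ * (R + 1) ≤ G * (R - 1) := by
    rw [le_div_iff₀ (by linarith)] at hε₁
    have : g * (R - 1) ≤ G * (R - 1) := by gcongr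
    linarith
  have hlt : Λ * ε₀ < G := by nlinarith
  have hmeas : ∀ j, MeasurableSet (E j) := fun j =>
    ((((contDiffOn_branch hΦ₀ θ j).continuousOn.mono (hVo j)).isOpen_inter_preimage
      Metric.isOpen_thickening Metric.isOpen_thickening).inter Metric.isOpen_ball).measurableSet
  have hmain := tsum_volume_boundary_le (f := pulled Φ₀ γ) (θ := θ) (ω := Λ * ε₀)
    (a := fun i : Fin (n + 1) => γ ^ (i : ℕ) * L) hL hρ hs
    (fun p hp => ((contDiffOn_pulled hΦ₀).contDiffAt ((isOpen_openBox _ L γ β).mem_nhds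
      (hball' p hp))).differentiableAt (by norm_num))
    (fun p hp => (hΛ p (hball p hp) x (hball x hxb)).trans
      (mul_le_mul_of_nonneg_left (hdistx p hp) hΛ0)) hlt
    (fun p hp => ((hΛ₀ p (hball p hp) x (hball x hxb)).trans
      (mul_le_mul_of_nonneg_left (hdistx p hp) hΛ₀0)).trans hε₂)
    (fun i => by
      have h1 : γ ^ n ≤ γ ^ (i : ℕ) := pow_le_pow_of_le_one hγ.le hγ1 (by have := i.2; omega)
      have h2 : γ ^ n * L ≤ γ ^ (i : ℕ) * L := by gcongr
      linarith) hmeas (fun j p hp => hp.2) (fun j p hp => by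
        obtain ⟨q, hq, hqp⟩ := exists_boundary_point_near hσ0 hγ hβ hΦ₀ θ j (hexp j) (hVo j) hp.1
        have h1 := (closure_piece_subset hγ hβ hΦ₀ θ j hq.1).2
        exact ⟨q, hqp, h1.1, h1.2, boundary_piece_cases hγ hβ hΦ₀ θ j hq⟩)
  have hquot : (G + Λ * ε₀) / (G - Λ * ε₀) ≤ R := by
    rw [div_le_iff₀ (by linarith)]
    linarith
  refine (ENNReal.div_le_div_right hmain _).trans ?_
  rw [← ENNReal.ofReal_div_of_pos (by positivity)]
  refine ENNReal.ofReal_le_ofReal ?_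
  have hsρ : s / ρ = 1 / (√σ - 1) * (ε / δ) := by
    have h1 : √σ - 1 ≠ 0 := by linarith
    have h2 : (1 - 1 / √σ) * √σ = √σ - 1 := by field_simp
    rw [hsdef, hρdef, div_div, ← mul_assoc, mul_comm √σ, h2]
    field_simp
  calc unitBallVol n * ρ ^ n * (2 * s) * (2 * ((G + Λ * ε₀) / (G - Λ * ε₀)) + (n + 1)) /
        (unitBallVol (n + 1) * ρ ^ (n + 1))
      = 2 * (unitBallVol n / unitBallVol (n + 1)) *
          (2 * ((G + Λ * ε₀) / (G - Λ * ε₀)) + (n + 1)) * (s / ρ) := by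
        field_simp
        ring
    _ ≤ 2 * (unitBallVol n / unitBallVol (n + 1)) * (2 * R + (n + 1)) * (s / ρ) := by
        gcongr
    _ = 2 / (√σ - 1) * (unitBallVol n / unitBallVol (n + 1)) * (2 * R + (n + 1)) * (ε / δ) := by
        rw [hsρ]
        ring

theorem exists_geomConst_bound (hσ : 1 < σ) (heta : eta0 (n + 1) (crossings (n + 1)) σ < 1)
    (hL : 0 < L) (hγ : 0 < γ) (hγ1 : γ ≤ 1) (hβ : 0 < β)
    (hΦ₀ : ContDiffOn ℝ 2 Φ₀ (openCube (n + 1) (L + β)))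
    (hexp : ∀ (θ : ℝ) (j : ℤ), ∀ u ∈ openBox (n + 1) L γ β, ∀ v ∈ openBox (n + 1) L γ β,
      √σ * dist u v ≤ dist (branch Φ₀ L γ θ j u) (branch Φ₀ L γ θ j v))
    {g εm : ℝ} (hg : 0 < g)
    (hgrad : ∀ u ∈ openBox (n + 1) L γ β, g ≤ ‖fderiv ℝ (pulled Φ₀ γ) u‖)
    (hεm : εm ≤ γ ^ n * (β / 4)) :
    ∃ ε₀ : ℝ, 0 < ε₀ ∧ ∀ θ : ℝ, (⨆ δ ∈ Ioc (0 : ℝ) ε₀, geomConst Φ₀ L γ θ εm σ δ) < 1 := by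
  have hσ1 : 1 < √σ := Real.lt_sqrt_of_sq_lt (by simpa using hσ)
  have hopen := isOpen_openBox (n + 1) L γ β
  have hsub : closedBox (n + 1) L γ (β / 2) ⊆ openBox (n + 1) L γ β :=
    closedBox_subset_openBox hγ (by linarith)
  have hC := contDiffOn_pulled (γ := γ) hΦ₀
  obtain ⟨Λ, hΛ⟩ := ((hC.fderiv_of_isOpen (m := 1) hopen (by norm_num)).mono
    hsub).exists_lipschitzOnWith (by norm_num) (convex_closedBox _ L γ _)
      (isCompact_closedBox _ L γ _)
  obtain ⟨Λ₀, hΛ₀⟩ := (hC.mono hsub).exists_lipschitzOnWith (by norm_num)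
    (convex_closedBox _ L γ _) (isCompact_closedBox _ L γ _)
  -- the factor `R > 1` leaves half of the room given by `η₀(σ) < 1`
  set A := 4 / (√σ - 1) * (unitBallVol n / unitBallVol (n + 1)) with hA
  have hA0 : 0 < A := mul_pos (div_pos four_pos (by linarith))
    (div_pos (unitBallVol_pos _) (unitBallVol_pos _))
  have heta' : 1 / √σ + A * (n + 3) < 1 := by
    have h1 : eta0 (n + 1) (crossings (n + 1)) σ = 1 / √σ + A * (n + 3) := by
      rw [eta0, crossings, hA, Nat.add_sub_cancel]
      push_cast
      ring
    linarith
  set R := 1 + (1 - (1 / √σ + A * (n + 3))) / (4 * A) with hRdef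
  have hR : 1 < R := by
    have : 0 < (1 - (1 / √σ + A * (n + 3))) / (4 * A) := div_pos (by linarith) (by linarith)
    linarith
  set c := 2 / (√σ - 1) * (unitBallVol n / unitBallVol (n + 1)) * (2 * R + (n + 1)) with hcdef
  have hc1 : 1 / √σ + 2 * c < 1 := by
    have h1 : 2 * c = A * (2 * R + (n + 1)) := by rw [hcdef, hA]; ring
    have h2 : A * (2 * R) = 2 * A + (1 - (1 / √σ + A * (n + 3))) / 2 := by
      rw [hRdef]
      field_simp
      ring
    rw [h1]
    linarith
  have hc0 : 0 ≤ c := by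
    have h1 : 2 * c = A * (2 * R + (n + 1)) := by rw [hcdef, hA]; ring
    have : 0 ≤ A * (2 * R + (n + 1)) := by positivity
    linarith
  have hbound : ∀ {a b : ℝ}, 0 ≤ a → 0 < b → a * (b / (a + 1)) ≤ b := by
    intro a b ha hb
    rw [← mul_div_assoc, div_le_iff₀ (by linarith)]
    nlinarith
  have hb0 : 0 < g * (R - 1) / (R + 1) := by
    have : 0 < R - 1 := by linarith
    positivity
  set ε₀ := min (min (g * (R - 1) / (R + 1) / ((Λ : ℝ) + 1)) (L / 2 / ((Λ₀ : ℝ) + 1)))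
    (min (γ ^ n * L) (γ ^ n * (β / 8)))
  have hε₀ : 0 < ε₀ := by positivity
  refine ⟨ε₀, hε₀, fun θ => ?_⟩
  refine lt_of_le_of_lt (b := ENNReal.ofReal (1 / √σ + 2 * c)) (iSup₂_le fun δ hδ => ?_) ?_
  · refine geomConst_le hc0 fun ε hε hεδ x => ?_
    refine boundaryRatio_le hσ hL hγ hγ1 hβ hΦ₀ (hexp θ) hg hgrad Λ.2 Λ₀.2
      (fun p hp q hq => by rw [← dist_eq_norm]; exact hΛ.dist_le_mul p hp q hq)
      (fun p hp q hq => by rw [← Real.dist_eq]; exact hΛ₀.dist_le_mul p hp q hq) hR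
      (ε₀ := ε₀) ?_ ?_ ?_ ?_ hεm hε hεδ hδ.2 x
    · exact (mul_le_mul_of_nonneg_left ((min_le_left _ _).trans (min_le_left _ _)) Λ.2).trans
        (hbound Λ.2 hb0)
    · exact (mul_le_mul_of_nonneg_left ((min_le_left _ _).trans (min_le_right _ _)) Λ₀.2).trans
        (hbound Λ₀.2 (by positivity))
    · exact (min_le_right _ _).trans (min_le_left _ _)
    · exact (min_le_right _ _).trans (min_le_right _ _)
  · rw [← ENNReal.ofReal_one]
    exact (ENNReal.ofReal_lt_ofReal_iff one_pos).2 hc1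

end Ratio

/-! ### The family of transformations -/

theorem mainTheorem1 (k : ℕ) (hk : 2 ≤ k) (L β : ℝ) (hL : 0 < L) (hβ : 0 < β)
    (Φ₀ : Euc k → ℝ) (hΦ₀ : ContDiffOn ℝ 2 Φ₀ (openCube k (L + β)))
    (σ C₁ C₂ γ : ℝ) (hσ : threshold k (crossings k) < σ) (hC₁ : 1 < C₁) (hC₂ : 1 < C₂)
    (hγ : 0 < γ) (hγσ : γ ^ (-2 : ℤ) = C₁ * σ)
    (hfirst : ∀ x ∈ openCube k (L + β), ∀ i : Fin k, (i : ℕ) = 0 →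
      C₁ ^ (k - 1) * C₂ * σ ^ k ≤ partialDeriv Φ₀ i x ^ 2)
    (hother : ∀ x ∈ openCube k (L + β), ∀ i : Fin k, 1 ≤ (i : ℕ) →
      partialDeriv Φ₀ i x ^ 2 ≤ (C₁ - 1) * (C₂ - 1) / ((k : ℝ) - 1) * σ) :
    ∃ r₀ εm K ε₀ : ℝ, 0 < r₀ ∧ 0 < εm ∧ 0 < K ∧ 0 < ε₀ ∧ ∀ θ : ℝ,
      -- (PRE)
      ({j : ℤ | (piece Φ₀ L γ θ j).Nonempty}.Finite ∧
        (∀ j, IsOpen (piece Φ₀ L γ θ j) ∧ piece Φ₀ L γ θ j ⊆ box k L γ) ∧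
        (∀ i j, i ≠ j → Disjoint (piece Φ₀ L γ θ i) (piece Φ₀ L γ θ j)) ∧
        (∀ j, closure (piece Φ₀ L γ θ j) ⊆ enlargedPiece Φ₀ L γ θ εm j ∧
          enlargedPiece Φ₀ L γ θ εm j ⊆ openBox k L γ β ∧
          ContDiffOn ℝ 2 (branch Φ₀ L γ θ j) (enlargedPiece Φ₀ L γ θ εm j))) ∧
      -- (PE1)
      (∀ j, EqOn (transf Φ₀ L γ θ) (branch Φ₀ L γ θ j) (piece Φ₀ L γ θ j) ∧
        Metric.thickening r₀ (transf Φ₀ L γ θ '' piece Φ₀ L γ θ j) ⊆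
          branch Φ₀ L γ θ j '' enlargedPiece Φ₀ L γ θ εm j) ∧
      -- (PE2)
      (∀ j, IsC2DiffeoOn (branch Φ₀ L γ θ j) (enlargedPiece Φ₀ L γ θ εm j) ∧
        ∀ ε ∈ Ioo 0 ε₀, ∀ z ∈ branch Φ₀ L γ θ j '' enlargedPiece Φ₀ L γ θ εm j,
          ∀ x ∈ Metric.ball z ε ∩ branch Φ₀ L γ θ j '' enlargedPiece Φ₀ L γ θ εm j,
          ∀ y ∈ Metric.ball z ε ∩ branch Φ₀ L γ θ j '' enlargedPiece Φ₀ L γ θ εm j,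
            |(fderiv ℝ (branchInv Φ₀ L γ θ εm j) x).det -
                (fderiv ℝ (branchInv Φ₀ L γ θ εm j) y).det| ≤
              K * |(fderiv ℝ (branchInv Φ₀ L γ θ εm j) z).det| * ε) ∧
      -- (PE3)
      volume (box k L γ \ ⋃ j : ℤ, piece Φ₀ L γ θ j) = 0 ∧
      -- (PE4)
      (∀ j, ∀ u ∈ branch Φ₀ L γ θ j '' enlargedPiece Φ₀ L γ θ εm j,
        ∀ v ∈ branch Φ₀ L γ θ j '' enlargedPiece Φ₀ L γ θ εm j, dist u v ≤ ε₀ →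
          dist (branchInv Φ₀ L γ θ εm j u) (branchInv Φ₀ L γ θ εm j v) ≤
            1 / √σ * dist u v) ∧
      -- (PE5)
      (⨆ δ ∈ Ioc (0 : ℝ) ε₀, geomConst Φ₀ L γ θ εm σ δ) < 1 := by

  obtain ⟨n, rfl⟩ : ∃ n, k = n + 1 := ⟨k - 1, by omega⟩
  have hn : 1 ≤ n := by omega
  rw [Nat.add_sub_cancel] at hfirst
  obtain ⟨hσ1, heta⟩ := one_lt_and_eta0_lt_one_of_threshold_lt (by simp [crossings]) hσ
  have hσ0 : 0 < √σ := Real.sqrt_pos.2 (by linarith)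
  have hγ2 : γ ^ 2 * (C₁ * σ) = 1 := by
    rw [← hγσ, zpow_neg]
    exact mul_inv_cancel₀ (by positivity)
  have hγ1 : γ ≤ 1 := by
    by_contra! h
    have h1 : 1 < C₁ * σ := by nlinarith
    nlinarith
  have hfirst' : ∀ x ∈ openCube (n + 1) (L + β),
      C₁ ^ n * C₂ * σ ^ (n + 1) ≤ partialDeriv Φ₀ 0 x ^ 2 := fun x hx => hfirst x hx 0 rfl
  have hexp : ∀ (θ : ℝ) (j : ℤ), ∀ u ∈ openBox (n + 1) L γ β, ∀ v ∈ openBox (n + 1) L γ β,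
      √σ * dist u v ≤ dist (branch Φ₀ L γ θ j u) (branch Φ₀ L γ θ j v) :=
    fun θ j u hu v hv => sqrt_mul_dist_le_dist_branch hn hΦ₀ hσ1 hC₁ hC₂ hγ hγ2 hfirst'
      (fun x hx i => by simpa using hother x hx i.succ (by simp)) θ j hu hv
  have hM : 0 < C₁ ^ n * C₂ * σ ^ (n + 1) := by positivity
  set εm := γ ^ n * (β / 4) with hεm
  have hεm0 : 0 < εm := by positivity
  obtain ⟨ε₀, hε₀, hη⟩ := exists_geomConst_bound hσ1 heta hL hγ hγ1 hβ hΦ₀ hexp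
    (Real.sqrt_pos.2 hM) (fun u hu => le_norm_fderiv_pulled hΦ₀ hfirst' hu) hεm.le
  obtain ⟨K, hK, hdist⟩ := exists_distortion_bound hσ0 hγ (show β / 4 < β by linarith) hΦ₀ hexp
  have hVc : ∀ θ j, enlargedPiece Φ₀ L γ θ εm j ⊆ closedBox (n + 1) L γ (β / 4) := fun θ j =>
    enlargedPiece_subset_closedBox hγ hγ1 (by positivity) hεm.le θ j
  have hVo : ∀ θ j, enlargedPiece Φ₀ L γ θ εm j ⊆ openBox (n + 1) L γ β := fun θ j =>
    (hVc θ j).trans (closedBox_subset_openBox hγ (by linarith))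
  have hexpV : ∀ θ j, ∀ u ∈ enlargedPiece Φ₀ L γ θ εm j, ∀ v ∈ enlargedPiece Φ₀ L γ θ εm j,
      √σ * dist u v ≤ dist (branch Φ₀ L γ θ j u) (branch Φ₀ L γ θ j v) :=
    fun θ j u hu v hv => hexp θ j u (hVo θ j hu) v (hVo θ j hv)
  have hCV : ∀ θ j, ContDiffOn ℝ 2 (branch Φ₀ L γ θ j) (enlargedPiece Φ₀ L γ θ εm j) :=
    fun θ j => (contDiffOn_branch hΦ₀ θ j).mono (hVo θ j)
  have hVopen : ∀ θ j, IsOpen (enlargedPiece Φ₀ L γ θ εm j) := fun θ j =>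
    Metric.isOpen_thickening
  refine ⟨√σ * (εm / 2) / 2, εm, K, ε₀, by positivity, hεm0, hK, hε₀, fun θ =>
    ⟨⟨finite_nonempty_piece hL hγ hβ hΦ₀ θ, fun j => ⟨isOpen_piece hγ hβ hΦ₀ θ j, ?_⟩,
      fun i j hij => disjoint_piece hL θ hij, fun j =>
        ⟨Metric.closure_subset_thickening hεm0 _, hVo θ j, hCV θ j⟩⟩,
      fun j => ⟨transf_eqOn_branch hL θ j,
        thickening_transf_subset hL hσ0 hΦ₀ θ j (hexp θ j) hεm0 (hVo θ j)⟩,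
      fun j => ⟨⟨hVopen θ j, injOn_of_expanding hσ0 (hexpV θ j), hCV θ j,
        isOpen_image_of_expanding (hVopen θ j) hσ0 (hexpV θ j) (hCV θ j) (hVopen θ j) Subset.rfl,
        contDiffOn_invFunOn_of_expanding (hVopen θ j) hσ0 (hexpV θ j) (hCV θ j)⟩,
        fun ε hε => hdist θ j _ (hVopen θ j) (hVc θ j) ε hε.1⟩,
      volume_box_diff_iUnion_piece n.succ_pos hσ0 hL hγ hβ hΦ₀ (hexp 0 0) θ, ?_, hη θ⟩⟩
  · rw [box_eq_closedBox]
    exact piece_subset_closedBox hγ θ j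
  · rintro j _ ⟨u, hu, rfl⟩ _ ⟨v, hv, rfl⟩ -
    have hinv := (injOn_of_expanding hσ0 (hexpV θ j)).leftInvOn_invFunOn
    rw [branchInv, hinv hu, hinv hv, one_div_mul_eq_div, le_div_iff₀ hσ0, mul_comm]
    exact hexpV θ j u hu v hv
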